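/- Let $k$ be a field of characteristic $p>0$, and let $H$ be a height-one group scheme over $k$, that is, a group scheme of finite type whose relative Frobenius $H\to H^{(p)}$ is trivial. Write $\mathfrak h=\operatorname{Lie}(H)$. (A) Let $F$ be an extension field of $k$, and suppose that $H$ acts faithfully on the scheme $\operatorname{Spec}(F)$. Differentiating the action gives a $k$-linear map $\mathfrak h\to\operatorname{Der}_k(F)$. Let $E=F^{\mathfrak h}$ be the intersection of the kernels of the derivations from $\mathfrak h$, so that $\mathfrak h\to\operatorname{Der}_k(F)$ takes values in $\operatorname{Der}_E(F)$, and let $\mathfrak h\cdot E$ and $\mathfrak h\cdot F$ be the $E$-linear and the $F$-linear span of its image in $\operatorname{Der}_E(F)$. Then the following holds: 1. The map $\mathfrak h\to\operatorname{Der}_k(F)$ is injective, its image contains an $F$-basis of $\operatorname{Der}_E(F)$, and $\mathfrak h\cdot F=\operatorname{Der}_E(F)$. 2. $F^{\mathfrak h}=F^{\mathfrak h\cdot E}=F^{\mathfrak h\cdot F}$. 3. The subspace $\mathfrak h\cdot E\subset \operatorname{Der}_E(F)$ is stable under brackets and under the $p$-map $D\mapsto D^p$. 4. The field extension $E\subset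 F$ is finite, of degree $[F:E]=p^{\dim_F(\mathfrak h\cdot F)}$. 5. The action of $H$ on $Z=\operatorname{Spec}(F)$ induces an action of the base change $H_E=H\otimes_kE$ on the $E$-scheme $Z$, and this action is transitive: the morphism $H_E\times Z\to Z\times Z$, $(g,a)\mapsto(g\cdot a,a)$ is an epimorphism of fppf sheaves over $E$. 6. Set $H_F=H\otimes_kF$ and $Z_F=Z\otimes_EF=\operatorname{Spec}(F\otimes_EF)$, let $z_0\in Z_F$ be the $F$-rational point given by the multiplication map $F\otimes_EF\to F$, and let $H_F^{\mathrm{inert}}\subset H_F$ be the inertia subgroup scheme, that is, the stabilizer of $z_0$. Then the orbit map $H_F\to Z_F$, $g\mapsto g\cdot z_0$ induces an identification $H_F/H_F^{\mathrm{inert}}=\operatorname{Spec}(F\otimes_EF)$, where the quotient is formed as an fppf sheaf. 7. The canonical map $\mathfrak h\otimes_kF\to\operatorname{Lie}(H_F)$ is bijective, the canonical map $\mathfrak h\otimes_kF\to\operatorname{Der}_E(F)$ is surjective, and the kernel of the latter is the inertia Lie algebra $\mathfrak h_F^{\mathrm{inert}}=\operatorname{Lie}(H_F^{\mathrm{inert}})$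 inside $\mathfrak h_F=\operatorname{Lie}(H_F)=\mathfrak h\otimes_kF$. 8. $[F:E]=p^c$, where $c$ is the codimension of $\mathfrak h_F^{\mathrm{inert}}\subset\mathfrak h_F$. (B) Let $X$ be a proper integral scheme over $k$ with function field $F=k(X)$, and suppose that $H$ is the Frobenius kernel (the kernel of the relative Frobenius) of the automorphism group scheme $\operatorname{Aut}_{X/k}$, with its canonical action on $X$. Let $q:X\to Y=X/H$ be the quotient: $q$ is a homeomorphism, and $\mathcal O_Y$ is identified with the sheaf of $H$-invariant sections of $\mathcal O_X$. Then the $H$-action on $X$ induces an action on $\operatorname{Spec}(F)$ for which the inclusion of the generic point $\operatorname{Spec}(F)\to X$ is equivariant, this action is faithful, and the foliation rank of $X$, defined as the integer $r\ge 0$ with $\deg(X/Y)=[k(X):k(Y)]=p^r$, exists and equals the codimension of $\mathfrak h_F^{\mathrm{inert}}\subset\mathfrak h_F$ formed for this action as in (A). -/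

import Mathlib

open scoped TensorProduct

universe u

noncomputable section

namespace HeightOneAction

section Algebraic

variable (p : ℕ) (k A : Type u) [Field k] [CommRing A] [HopfAlgebra k A]

/-- The affine group scheme `H = Spec A` over a field `k` of characteristic `p` is of height one:
it is of finite type, and its relative Frobenius `H → H^(p)`, given on coordinate rings by
`A ⊗[k, Frob] k → A, a ⊗ c ↦ c * a ^ p`, is the trivial homomorphism, that is, it factors
through the counit of `A`. -/
structure IsHeightOne : Prop where
  finiteType : Algebra.FiniteType k A
  frobenius_trivial : ∀ a : A, a ^ p = algebraMap k A (Coalgebra.counit (R := k) a ^ p)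

/-- The group `H(R)` of `R`-valued points of `H = Spec A`, the algebra homomorphisms `A → R`
under convolution. If `R` is an algebra over an extension `L` of `k`, this is also the group
`H_L(R)` of points of the base change `H_L = H ⊗ L`. -/
abbrev Points (R : Type u) [CommRing R] [Algebra k R] : Type u := WithConv (A →ₐ[k] R)

lemma Points.inv_mul_cancel_aux {R : Type u} [CommRing R] [Algebra k R] (g : Points k A R) :
    WithConv.toConv (g.ofConv.comp (HopfAlgebra.antipodeAlgHom k A)) * g = 1 := by
  have key : ∀ x : A ⊗[k] A, Algebra.TensorProduct.lmul' k (Algebra.TensorProduct.map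
      (g.ofConv.comp (HopfAlgebra.antipodeAlgHom k A)) g.ofConv x) =
      g.ofConv (LinearMap.mul' k A ((HopfAlgebra.antipode k (A := A)).rTensor A x)) := by
    intro x
    induction x using TensorProduct.induction_on with
    | zero => simp
    | add x y hx hy => simp only [map_add, hx, hy]
    | tmul a b => simp
  apply WithConv.ofConv_injective
  ext a
  have h := HopfAlgebra.mul_antipode_rTensor_comul_apply (R := k) a
  simp only [AlgHom.convMul_def, AlgHom.convOne_def, WithConv.ofConv_toConv, AlgHom.comp_apply,
    Bialgebra.comulAlgHom_apply, key, h, Bialgebra.counitAlgHom_apply, Algebra.ofId_apply,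
    AlgHom.commutes]

instance Points.group (R : Type u) [CommRing R] [Algebra k R] : Group (Points k A R) where
  inv g := WithConv.toConv (g.ofConv.comp (HopfAlgebra.antipodeAlgHom k A))
  inv_mul_cancel g := Points.inv_mul_cancel_aux k A g

variable {k A} in
/-- The image of a point under a change of rings `R → S`. -/
def Points.map {R : Type u} [CommRing R] [Algebra k R] (S : Type u) [CommRing S] [Algebra k S]
    [Algebra R S] [IsScalarTower k R S] (g : Points k A R) : Points k A S :=
  WithConv.toConv ((IsScalarTower.toAlgHom k R S).comp g.ofConv)

/-- The Lie algebra of the base change `H_L`, as an `L`-vector space: the `k`-linear maps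
`D : A → L` that are derivations at the unit element. These are exactly the maps for which
`a ↦ ε(a) + D(a) ε` is an element of the kernel of `H(L[ε]) → H(L)`. -/
def lieAlgebra (L : Type u) [CommRing L] [Algebra k L] : Submodule L (A →ₗ[k] L) where
  carrier := {D | ∀ a b : A, D (a * b) =
    algebraMap k L (Coalgebra.counit (R := k) a) * D b +
      algebraMap k L (Coalgebra.counit (R := k) b) * D a}
  add_mem' := by
    intro D D' h h' a b
    simp only [LinearMap.add_apply, h a b, h' a b]
    ring
  zero_mem' := by intro a b; simp
  smul_mem' := by
    intro c D h a b
    simp only [LinearMap.smul_apply, h a b, smul_eq_mul]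
    ring

/-- The underlying `k`-vector space of `Lie(H)`. -/
abbrev Lie : Type u := lieAlgebra k A k

/-- The underlying `L`-vector space of `Lie(H_L)`. -/
abbrev LieExt (L : Type u) [CommRing L] [Algebra k L] : Type u := lieAlgebra k A L

instance (L : Type u) [CommRing L] [Algebra k L] : AddCommGroup (LieExt k A L) :=
  Submodule.addCommGroup (lieAlgebra k A L)

/-- The extension of scalars `Lie(H) → Lie(H_L)`. -/
def lieExtend (L : Type u) [CommRing L] [Algebra k L] : Lie k A →ₗ[k] LieExt k A L where
  toFun D := ⟨(Algebra.linearMap k L).comp D.1, by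
    intro a b
    have h := D.2 a b
    simp only [LinearMap.comp_apply, h, Algebra.linearMap_apply, map_add, map_mul]
    simp⟩
  map_add' D D' := by
    ext a
    simp
  map_smul' c D := by
    ext a
    simp [Algebra.smul_def]

/-- The canonical map `L ⊗ Lie(H) → Lie(H_L)`. -/
def lieBaseChange (L : Type u) [CommRing L] [Algebra k L] : L ⊗[k] Lie k A →ₗ[L] LieExt k A L :=
  (lieExtend k A L).liftBaseChange L

/-- The element `a ↦ ε(a) + D(a) ε` of `H(L[ε])` given by `D` in `Lie(H_L)`. -/
def tangentPoint (L : Type u) [CommRing L] [Algebra k L] (D : LieExt k A L) :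
    Points k A (DualNumber L) :=
  WithConv.toConv <| AlgHom.ofLinearMap
    ((TrivSqZeroExt.inlAlgHom k L L).toLinearMap ∘ₗ Algebra.linearMap k L ∘ₗ Coalgebra.counit +
      ((TrivSqZeroExt.inrHom L L).restrictScalars k) ∘ₗ D.1)
    (by
      have h := D.2 1 1
      simp only [mul_one, Bialgebra.counit_one, map_one, one_mul] at h
      have h0 : D.1 1 = 0 := by simpa using h
      simp [h0])
    (by
      intro a b
      have h := D.2 a b
      ext
      · simp [TrivSqZeroExt.algebraMap_eq_inl']
      · simp [h, TrivSqZeroExt.algebraMap_eq_inl', mul_comm])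

variable {k A} in
/-- An action of the group scheme `H = Spec A` on the affine scheme `Spec C`, given by its
comorphism `C → A ⊗ C`. -/
structure Action (C : Type u) [CommRing C] [Algebra k C] where
  coact : C →ₐ[k] A ⊗[k] C
  counit_coact : ∀ c : C, Algebra.TensorProduct.lid k C
    (Algebra.TensorProduct.map (Bialgebra.counitAlgHom k A) (AlgHom.id k C) (coact c)) = c
  comul_coact : ∀ c : C, Algebra.TensorProduct.assoc k k k A A C
      (Algebra.TensorProduct.map (Bialgebra.comulAlgHom k A) (AlgHom.id k C) (coact c)) =
    Algebra.TensorProduct.map (AlgHom.id k A) coact (coact c)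

namespace Action

variable {k A}
variable {C : Type u} [CommRing C] [Algebra k C] (ρ : Action (k := k) (A := A) C)

/-- The action of `g ∈ H(R)` on an `R`-valued point `z` of `Spec C`. -/
def act {R : Type u} [CommRing R] [Algebra k R] (g : Points k A R) (z : C →ₐ[k] R) : C →ₐ[k] R :=
  (Algebra.TensorProduct.productMap g.ofConv z).comp ρ.coact

lemma act_one {R : Type u} [CommRing R] [Algebra k R] (z : C →ₐ[k] R) : ρ.act 1 z = z := by
  have key : Algebra.TensorProduct.productMap (1 : Points k A R).ofConv z =
      z.comp ((Algebra.TensorProduct.lid k C).toAlgHom.comp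
        (Algebra.TensorProduct.map (Bialgebra.counitAlgHom k A) (AlgHom.id k C))) := by
    apply Algebra.TensorProduct.ext'
    intro a c
    simp [AlgHom.convOne_def, Algebra.smul_def, Algebra.ofId_apply]
  ext c
  have := congrArg z (ρ.counit_coact c)
  simp only [act, key]
  simpa using this

lemma act_mul {R : Type u} [CommRing R] [Algebra k R] (g h : Points k A R) (z : C →ₐ[k] R) :
    ρ.act (g * h) z = ρ.act g (ρ.act h z) := by
  have key1 : Algebra.TensorProduct.productMap (g * h).ofConv z =
      ((Algebra.TensorProduct.productMap g.ofConv
        (Algebra.TensorProduct.productMap h.ofConv z)).comp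
        (Algebra.TensorProduct.assoc k k k A A C).toAlgHom).comp
        (Algebra.TensorProduct.map (Bialgebra.comulAlgHom k A) (AlgHom.id k C)) := by
    have key0 : ((Algebra.TensorProduct.productMap g.ofConv
        (Algebra.TensorProduct.productMap h.ofConv z)).comp
        (Algebra.TensorProduct.assoc k k k A A C).toAlgHom) =
        Algebra.TensorProduct.productMap
          (Algebra.TensorProduct.productMap g.ofConv h.ofConv) z := by
      ext x <;> simp [Algebra.TensorProduct.one_def]
    have key3 : (g * h).ofConv = (Algebra.TensorProduct.productMap g.ofConv h.ofConv).comp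
        (Bialgebra.comulAlgHom k A) := by
      have key4 : (Algebra.TensorProduct.lmul' k).comp
          (Algebra.TensorProduct.map g.ofConv h.ofConv) =
            Algebra.TensorProduct.productMap g.ofConv h.ofConv := by
        apply Algebra.TensorProduct.ext'
        intro a b
        simp
      rw [← key4]
      rfl
    rw [key0, key3]
    apply Algebra.TensorProduct.ext'
    intro a c
    simp
  have key2 : Algebra.TensorProduct.productMap g.ofConv (ρ.act h z) =
      (Algebra.TensorProduct.productMap g.ofConv
        (Algebra.TensorProduct.productMap h.ofConv z)).comp
        (Algebra.TensorProduct.map (AlgHom.id k A) ρ.coact) := by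
    apply Algebra.TensorProduct.ext'
    intro a c
    simp [act]
  ext c
  have := congrArg (Algebra.TensorProduct.productMap g.ofConv
        (Algebra.TensorProduct.productMap h.ofConv z)) (ρ.comul_coact c)
  rw [act, key1, act, key2]
  simpa using this

/-- The left action of `H(R)` on the `R`-valued points of `Spec C`. -/
abbrev mulAction (R : Type u) [CommRing R] [Algebra k R] :
    MulAction (Points k A R) (C →ₐ[k] R) where
  smul := ρ.act
  one_smul := ρ.act_one
  mul_smul := ρ.act_mul

/-- The action is faithful: an element of `H(R)` that acts trivially on `Spec(C) ⊗ R` (that is,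
on the `S`-valued points for all `R`-algebras `S`) is the unit element. -/
def Faithful : Prop :=
  ∀ (R : Type u) [CommRing R] [Algebra k R] (g : Points k A R),
    (∀ (S : Type u) [CommRing S] [Algebra k S] [Algebra R S] [IsScalarTower k R S]
      (z : C →ₐ[k] S), ρ.act (g.map S) z = z) → g = 1

/-- The derivation `(D ⊗ id) ∘ ρ` of `C` given by `D` in `Lie(H)`, that is, the derivative of the
action in the direction `D`. -/
def derivation : Lie k A →ₗ[k] Derivation k C C where
  toFun D := Derivation.mk'
    ((TensorProduct.lid k C).toLinearMap ∘ₗ D.1.rTensor C ∘ₗ ρ.coact.toLinearMap) (by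
      have key : ∀ x y : A ⊗[k] C, TensorProduct.lid k C (D.1.rTensor C (x * y)) =
          Algebra.TensorProduct.lid k C (Algebra.TensorProduct.map
            (Bialgebra.counitAlgHom k A) (AlgHom.id k C) x) *
              TensorProduct.lid k C (D.1.rTensor C y) +
          Algebra.TensorProduct.lid k C (Algebra.TensorProduct.map
            (Bialgebra.counitAlgHom k A) (AlgHom.id k C) y) *
              TensorProduct.lid k C (D.1.rTensor C x) := by
        intro x y
        induction x using TensorProduct.induction_on with
        | zero => simp
        | add x x' hx hx' => simp only [add_mul, map_add, hx, hx', mul_add]; ring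
        | tmul a c =>
          induction y using TensorProduct.induction_on with
          | zero => simp
          | add y y' hy hy' => simp only [mul_add, map_add, hy, hy', add_mul]; ring
          | tmul b d =>
            have h := D.2 a b
            simp only [Algebra.algebraMap_self, RingHom.id_apply] at h
            simp only [Algebra.TensorProduct.tmul_mul_tmul, LinearMap.rTensor_tmul, h,
              TensorProduct.lid_tmul, Algebra.TensorProduct.map_tmul,
              Algebra.TensorProduct.lid_tmul, Bialgebra.counitAlgHom_apply, AlgHom.id_apply,
              Algebra.smul_def, map_add, map_mul]
            ring
      intro c d
      simp only [LinearMap.comp_apply, AlgHom.toLinearMap_apply, map_mul, key, ρ.counit_coact,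
        LinearEquiv.coe_coe, smul_eq_mul])
  map_add' D D' := by
    ext c
    change TensorProduct.lid k C ((D.1 + D'.1).rTensor C (ρ.coact c)) =
      TensorProduct.lid k C (D.1.rTensor C (ρ.coact c)) +
        TensorProduct.lid k C (D'.1.rTensor C (ρ.coact c))
    rw [LinearMap.rTensor_add, LinearMap.add_apply, map_add]
  map_smul' r D := by
    ext c
    change TensorProduct.lid k C ((r • D.1).rTensor C (ρ.coact c)) =
      r • TensorProduct.lid k C (D.1.rTensor C (ρ.coact c))
    rw [LinearMap.rTensor_smul, LinearMap.smul_apply, map_smul]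

end Action

end Algebraic

section Field

variable {k A F : Type u} [Field k] [CommRing A] [HopfAlgebra k A] [Field F] [Algebra k F]
  (ρ : Action (k := k) (A := A) F)

namespace Action

/-- The intermediate field `E = F^𝔥`, the intersection of the kernels of the derivations that
belong to `𝔥 = Lie(H)`. -/
def fixedField : IntermediateField k F where
  carrier := {f | ∀ D : Lie k A, ρ.derivation D f = 0}
  mul_mem' := by
    intro a b ha hb D
    simp [ha D, hb D]
  add_mem' := by
    intro a b ha hb D
    simp [ha D, hb D]
  algebraMap_mem' := by
    intro r D
    simp
  inv_mem' := by
    intro a ha D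
    simp [Derivation.leibniz_inv, ha D]

/-- The map `𝔥 → Der_E(F)`. -/
def derivationE : Lie k A →ₗ[k] Derivation ρ.fixedField F F where
  toFun D := Derivation.mk'
    { toFun := ρ.derivation D
      map_add' := map_add _
      map_smul' := by
        rintro ⟨e, he⟩ f
        have h0 := he D
        simp [Algebra.smul_def, h0] }
    (by intro a b; simp)
  map_add' D D' := by
    ext f
    simp
  map_smul' r D := by
    ext f
    simp

/-- The `E`-subspace `𝔥 · E` of `Der_E(F)`. -/
def lieE : Submodule ρ.fixedField (Derivation ρ.fixedField F F) :=
  Submodule.span ρ.fixedField (Set.range ρ.derivationE)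

/-- The `F`-subspace `𝔥 · F` of `Der_E(F)`. -/
def lieF : Submodule F (Derivation ρ.fixedField F F) :=
  Submodule.span F (Set.range ρ.derivationE)

/-- The `F`-linearization `F ⊗ 𝔥 → Der_E(F)`. -/
def derivationF : F ⊗[k] Lie k A →ₗ[F] Derivation ρ.fixedField F F :=
  ρ.derivationE.liftBaseChange F

/-- The rational point `z₀` of `Spec(F ⊗[E] F)` over `F`, which is given by the multiplication map
`F ⊗[E] F → F`, with values in an `F`-algebra `R`. As an `R`-valued point of `Spec F`, it is the
structure map `F → R`. -/
def basePoint (k : Type u) {F : Type u} [Field k] [Field F] [Algebra k F]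
    (R : Type u) [CommRing R] [Algebra k R] [Algebra F R] [IsScalarTower k F R] : F →ₐ[k] R :=
  IsScalarTower.toAlgHom k F R

/-- The inertia subgroup scheme `H_F^inert` in `H_F`, on `R`-valued points: the stabilizer of the
rational point `z₀`. -/
def inertia (R : Type u) [CommRing R] [Algebra k R] [Algebra F R] [IsScalarTower k F R] :
    Subgroup (Points k A R) :=
  letI := ρ.mulAction R
  MulAction.stabilizer (Points k A R) (basePoint k (F := F) R)

lemma mem_inertia_tangentPoint (D : LieExt k A F) :
    tangentPoint k A F D ∈ ρ.inertia (DualNumber F) ↔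
      ∀ f : F, Algebra.TensorProduct.productMap (1 : Points k A F).ofConv (AlgHom.id k F)
          (ρ.coact f) = f ∧
        LinearMap.mul' k F (D.1.rTensor F (ρ.coact f)) = 0 := by
  have h1 : ∀ x : A ⊗[k] F,
      (Algebra.TensorProduct.productMap (tangentPoint k A F D).ofConv
        (basePoint k (F := F) (DualNumber F)) x) =
      TrivSqZeroExt.inl (Algebra.TensorProduct.productMap (1 : Points k A F).ofConv
        (AlgHom.id k F) x) +
      TrivSqZeroExt.inr (LinearMap.mul' k F (D.1.rTensor F x)) := by
    intro x
    induction x using TensorProduct.induction_on with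
    | zero => simp
    | add x y hx hy =>
      simp only [map_add, hx, hy, TrivSqZeroExt.inl_add, TrivSqZeroExt.inr_add]
      abel
    | tmul a f =>
      ext <;> simp [tangentPoint, basePoint, AlgHom.convOne_def, Algebra.ofId_apply,
        TrivSqZeroExt.algebraMap_eq_inl', mul_comm]
  have h2 : tangentPoint k A F D ∈ ρ.inertia (DualNumber F) ↔
      ρ.act (tangentPoint k A F D) (basePoint k (F := F) (DualNumber F)) =
        basePoint k (F := F) (DualNumber F) := Iff.rfl
  rw [h2, AlgHom.ext_iff]
  refine forall_congr' fun f => ?_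
  simp only [act, AlgHom.comp_apply, h1]
  rw [TrivSqZeroExt.ext_iff]
  simp [basePoint, TrivSqZeroExt.algebraMap_eq_inl]

/-- The inertia Lie algebra `𝔥_F^inert` in `Lie(H_F)`, the Lie algebra of the inertia subgroup
scheme: the elements whose points with values in `F[ε]` belong to the inertia subgroup. -/
def inertiaLie : Submodule F (LieExt k A F) where
  carrier := {D | tangentPoint k A F D ∈ ρ.inertia (DualNumber F)}
  add_mem' := by
    intro D D' h h'
    simp only [Set.mem_ofPred_eq, mem_inertia_tangentPoint] at h h' ⊢
    intro f
    refine ⟨(h f).1, ?_⟩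
    simp [LinearMap.rTensor_add, (h f).2, (h' f).2]
  zero_mem' := by
    simp only [Set.mem_ofPred_eq, mem_inertia_tangentPoint]
    intro f
    refine ⟨?_, by simp⟩
    have := AlgHom.congr_fun (ρ.act_one (AlgHom.id k F)) f
    simpa [act] using this
  smul_mem' := by
    intro c D h
    simp only [Set.mem_ofPred_eq, mem_inertia_tangentPoint] at h ⊢
    intro f
    refine ⟨(h f).1, ?_⟩
    have key : ∀ x : A ⊗[k] F, LinearMap.mul' k F (((c • D : LieExt k A F).1).rTensor F x) =
        c * LinearMap.mul' k F (D.1.rTensor F x) := by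
      intro x
      induction x using TensorProduct.induction_on with
      | zero => simp
      | add x y hx hy => simp only [map_add, hx, hy, mul_add]
      | tmul a f => simp [mul_assoc]
    rw [key, (h f).2, mul_zero]

/-- The codimension of the inertia Lie algebra in `Lie(H_F)`. -/
def inertiaCodim : ℕ := Module.finrank F (LieExt k A F ⧸ ρ.inertiaLie)

/-- The action of `H_E` on the `E`-scheme `Z = Spec F` is well-defined and transitive: `H_E × Z →
Z × Z, (g, a) ↦ (g · a, a)` is an epimorphism of fppf sheaves, in other words, any two points
`a, b` with values in an `E`-algebra `R` become conjugate over some fppf extension of `R`. -/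
def IsTransitive : Prop :=
  ∀ (R : Type u) [CommRing R] [Algebra k R] [Algebra ρ.fixedField R]
    [IsScalarTower k ρ.fixedField R],
    (∀ (g : Points k A R) (a : F →ₐ[ρ.fixedField] R) (e : ρ.fixedField),
      ρ.act g (a.restrictScalars k) (e : F) = algebraMap ρ.fixedField R e) ∧
    ∀ a b : F →ₐ[ρ.fixedField] R,
      ∃ (S : Type u) (_ : CommRing S) (_ : Algebra R S) (_ : Algebra k S)
        (_ : IsScalarTower k R S),
        Module.FaithfullyFlat R S ∧ Algebra.FinitePresentation R S ∧
        ∃ g : Points k A S,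
          ρ.act g ((IsScalarTower.toAlgHom k R S).comp (a.restrictScalars k)) =
            (IsScalarTower.toAlgHom k R S).comp (b.restrictScalars k)

/-- A point `g ∈ H(R)` with values in an `F`-algebra `R`, viewed as an `R`-valued point of the
`F`-scheme `H_F = Spec(F ⊗[k] A)`. -/
def pointExt {R : Type u} [CommRing R] [Algebra k R] [Algebra F R] [IsScalarTower k F R]
    (g : Points k A R) : F ⊗[k] A →ₐ[F] R :=
  Algebra.TensorProduct.lift (Algebra.ofId F R) g.ofConv (fun _ _ => Commute.all _ _)

/-- The morphism of `F`-schemes `H_F = Spec(F ⊗[k] A) → Spec B` given by `π : B → F ⊗[k] A` induces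
an identification `H_F / H_F^inert = Spec B`, where the quotient is formed as fppf sheaf: two
points of `H_F` have the same image if and only if they lie in the same coset of the inertia
subgroup, and every point of `Spec B` lifts to `H_F` over some fppf extension. -/
def IsInertiaQuotient {B : Type u} [CommRing B] [Algebra F B] (π : B →ₐ[F] F ⊗[k] A) : Prop :=
  ∀ (R : Type u) [CommRing R] [Algebra k R] [Algebra F R] [IsScalarTower k F R],
    (∀ g g' : Points k A R,
      (pointExt g).comp π = (pointExt g').comp π ↔ g⁻¹ * g' ∈ ρ.inertia R) ∧
    ∀ z : B →ₐ[F] R,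
      ∃ (S : Type u) (_ : CommRing S) (_ : Algebra R S) (_ : Algebra k S) (_ : Algebra F S)
        (_ : IsScalarTower k F S) (_ : IsScalarTower F R S),
        Module.FaithfullyFlat R S ∧ Algebra.FinitePresentation R S ∧
        ∃ g : Points k A S, (pointExt g).comp π = (IsScalarTower.toAlgHom F R S).comp z

/-- `π` is the comorphism `F ⊗[E] F → F ⊗[k] A` of the orbit map `H_F → Spec(F ⊗[E] F), g ↦ g · z₀`.
Here the left factor `F` of `F ⊗[E] F` is the base field, and the right factor is the coordinate
ring of the `E`-scheme `Spec F`. -/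
def IsOrbitComorphism (π : F ⊗[ρ.fixedField] F →ₐ[F] F ⊗[k] A) : Prop :=
  ∀ c f : F, π (c ⊗ₜ f) = c • Algebra.TensorProduct.comm k A F (ρ.coact f)

end Action

end Field

section Schemes

open CategoryTheory AlgebraicGeometry MonoidalCategory CartesianMonoidalCategory
open scoped MonObj

variable (p : ℕ) [Fact p.Prime] (k A : Type u) [Field k] [CharP k p] [CommRing A] [HopfAlgebra k A]

/-- The spectrum of a `k`-algebra as a `k`-scheme. -/
abbrev specOver (R : Type u) [CommRing R] [Algebra k R] : Over (Spec (.of k)) :=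
  (Spec (.of R)).asOver (Spec (.of k))

variable {k} in
/-- The morphism of `k`-schemes given by a homomorphism of `k`-algebras. -/
abbrev specMap {R S : Type u} [CommRing R] [Algebra k R] [CommRing S] [Algebra k S]
    (φ : R →ₐ[k] S) : specOver k S ⟶ specOver k R :=
  Over.homMk (Spec.map (CommRingCat.ofHom φ.toRingHom)) (by
    change Spec.map (CommRingCat.ofHom φ.toRingHom) ≫
      Spec.map (CommRingCat.ofHom (algebraMap k R)) = Spec.map (CommRingCat.ofHom (algebraMap k S))
    rw [← Spec.map_comp, ← CommRingCat.ofHom_comp]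
    congr 2
    ext r
    exact φ.commutes r)

/-- For a `k`-algebra `R`, the scheme `Spec R` viewed as a `k`-scheme via the composition
`k → k → R` with the Frobenius of `k`. -/
abbrev frobTwist (R : Type u) [CommRing R] [Algebra k R] : Over (Spec (.of k)) :=
  Over.mk (Spec.map (CommRingCat.ofHom ((algebraMap k R).comp (frobenius k p))))

/-- The absolute Frobenius of `Spec R`, viewed as a morphism of `k`-schemes. -/
abbrev absFrob (R : Type u) [CommRing R] [Algebra k R] [CharP R p] :
    frobTwist p k R ⟶ specOver k R :=
  haveI : ExpChar R p := ExpChar.prime Fact.out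
  Over.homMk (Spec.map (CommRingCat.ofHom (frobenius R p))) (by
    change Spec.map (CommRingCat.ofHom (frobenius R p)) ≫
      Spec.map (CommRingCat.ofHom (algebraMap k R)) =
        Spec.map (CommRingCat.ofHom ((algebraMap k R).comp (frobenius k p)))
    rw [← Spec.map_comp, ← CommRingCat.ofHom_comp]
    congr 2
    ext r
    simp [frobenius_def])

variable {k A}

/-- The `R`-valued points of the Frobenius kernel of the group functor `Aut_{X/k}`. An automorphism
of the `R`-scheme `Spec(R) × X` is given by its component `φ : Spec(R) × X → X`, and it belongs to
the Frobenius kernel if its base change along the absolute Frobenius of `R` is the identity. -/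
def autFrobeniusKernel (X : Over (Spec (.of k))) (R : Type u) [CommRing R] [Algebra k R]
    [CharP R p] : Set (specOver k R ⊗ X ⟶ X) :=
  {φ | IsIso (lift (fst (specOver k R) X) φ) ∧
    (absFrob p k R ▷ X) ≫ φ = snd (frobTwist p k R) X}

/-- An action of the group scheme `H = Spec A` on `X` identifies `H` with the Frobenius kernel of
`Aut_{X/k}`: for every (non-zero) `k`-algebra `R`, sending `g ∈ H(R)` to the automorphism
`(t, x) ↦ (t, g(t) · x)` yields a bijection from `H(R)` to `Aut_{X/k}[F](R)`. -/
def IsAutFrobeniusKernel (X : Over (Spec (.of k))) [ModObj (specOver k A) X] : Prop :=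
  ∀ (R : Type u) [CommRing R] [Algebra k R] [CharP R p],
    Set.BijOn (fun g : A →ₐ[k] R => (specMap g ▷ X) ≫ ModObj.smul (M := specOver k A) (X := X))
      Set.univ (autFrobeniusKernel p X R)

variable (A) in
/-- The morphism `q : X → Y` is the quotient of `X` by an action of the height-one group scheme
`H = Spec A`: it is a homeomorphism, and the structure sheaf of `Y` is the sheaf of invariants,
formed by those sections whose pullbacks along the action `H × X → X` and the projection
`H × X → X` coincide. -/
structure IsQuotient {X Y : Over (Spec (.of k))} [ModObj (specOver k A) X] (q : X ⟶ Y) : Prop where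
  isHomeomorph : IsHomeomorph q.left
  invariant : ModObj.smul (M := specOver k A) (X := X) ≫ q = snd (specOver k A) X ≫ q
  injective : ∀ U : Y.left.Opens, Function.Injective (q.left.app U)
  range : ∀ (U : Y.left.Opens) (s : Γ(X.left, q.left ⁻¹ᵁ U)),
    s ∈ Set.range (q.left.app U) ↔
      ∀ (W : (specOver k A ⊗ X).left.Opens)
        (h : W ≤ (ModObj.smul (M := specOver k A) (X := X)).left ⁻¹ᵁ q.left ⁻¹ᵁ U)
        (h' : W ≤ (snd (specOver k A) X).left ⁻¹ᵁ q.left ⁻¹ᵁ U),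
        (ModObj.smul (M := specOver k A) (X := X)).left.appLE (q.left ⁻¹ᵁ U) W h s =
          (snd (specOver k A) X).left.appLE (q.left ⁻¹ᵁ U) W h' s

/-- The function field of an integral `k`-scheme. -/
abbrev FunctionField (X : Over (Spec (.of k))) [IsIntegral X.left] : Type u :=
  X.left.functionField

/-- The function field of an integral `k`-scheme is an extension field of `k`. -/
instance functionFieldAlgebra (X : Over (Spec (.of k))) [IsIntegral X.left] :
    Algebra k (FunctionField X) :=
  (Spec.preimage (X.left.fromSpecStalk (genericPoint X.left) ≫ X.hom)).hom.toAlgebra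

/-- The inclusion of the generic point. -/
def genericInclusion (X : Over (Spec (.of k))) [IsIntegral X.left] :
    specOver k (FunctionField X) ⟶ X :=
  Over.homMk (X.left.fromSpecStalk (genericPoint X.left)) (by
    exact (Spec.map_preimage
      (X.left.fromSpecStalk (genericPoint X.left) ≫ X.hom)).symm)

/-- The natural number `r` is the foliation rank for the quotient map `q : X → Y`: the degree of
`X` over `Y`, which is the degree of the function field of `X` over the function field of `Y`,
equals `p ^ r`. -/
def IsFoliationRank {X Y : Over (Spec (.of k))} [IsIntegral X.left] (q : X ⟶ Y) (r : ℕ) : Prop :=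
  letI := (q.left.stalkMap (genericPoint X.left)).hom.toAlgebra
  Module.Finite (Y.left.presheaf.stalk (q.left (genericPoint X.left))) (FunctionField X) ∧
    Module.finrank (Y.left.presheaf.stalk (q.left (genericPoint X.left))) (FunctionField X) = p ^ r

/-- The action `ρ` on the spectrum of the function field is the restriction of the given action on
`X`: the inclusion of the generic point is equivariant, on `R`-valued points. -/
def IsInducedAction (X : Over (Spec (.of k))) [IsIntegral X.left] [ModObj (specOver k A) X]
    (ρ : Action (k := k) (A := A) (FunctionField X)) : Prop :=
  ∀ (R : Type u) [CommRing R] [Algebra k R] (g : Points k A R) (z : FunctionField X →ₐ[k] R),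
    lift (specMap g.ofConv) (specMap z ≫ genericInclusion X) ≫
        ModObj.smul (M := specOver k A) (X := X) =
      specMap (ρ.act g z) ≫ genericInclusion X

end Schemes

end HeightOneAction

end

open CategoryTheory AlgebraicGeometry HeightOneAction

/-!
The theorem rests on the fact that the coordinate ring of a height-one group scheme is a truncated
polynomial algebra whose coordinates are dual to the Lie algebra. In suitable coordinates the orbit
map of the base point, formed over `F`, is a projection onto some of them, and the structure of `F`
over `E` can be read off. Throughout, `L` is an extension of `k`, `E = F^𝔥`, and `ε` is the
augmentation of `L ⊗ A`.

*Coordinates.* A height-one Hopf algebra is local with nilpotent augmentation ideal, and all `p`-th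
powers of elements of this ideal vanish. Elements `yᵢ` dual to a basis of the Lie algebra therefore
generate `L ⊗ A`; combining invariant derivations one finds derivations `∂ᵢ` with `∂ᵢ yⱼ = δᵢⱼ`
(`exists_dual_derivations`), and it follows that the monomials in the `yᵢ` with exponents `< p`
form a basis and that an element killed by some of the `∂ᵢ` is a polynomial in the other
coordinates (`mem_adjoin_image_of_derivation_eq_zero`).

*The orbit map.* Elements of `E` are invariant under `H` (`coact_of_mem_fixedField`), so the orbit
map of the base point has a comorphism `F ⊗[E] F → F ⊗[k] A`. It is injective by an argument in the
style of Artin's lemma (`linearIndependent_orbit`), and hence `F` is finite over `E`. Choose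
elements `fᵢ` of `F` dual to an `F`-basis of `𝔥 · F`. The images of `1 ⊗ fᵢ - fᵢ ⊗ 1` become one
block of a system of coordinates of `H_F`, while the derivations of the other block can be taken
from the kernel of `F ⊗ 𝔥 → Der_E(F)`, so that they kill the image of the comorphism. So this image
is exactly the algebra generated by the first block (`exists_adapted_coordinates`). Counting
monomials gives `[F : E] = p ^ dim(𝔥 · F)`; the coordinate ring of `H_F` is finite and free over
`F ⊗[E] F`, which makes the orbit map an fppf epimorphism; and a derivation of `F` over `E` is
determined by its values at the `fᵢ`, so `𝔥 · F = Der_E(F)`.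

*Brackets and `p`-th powers.* Under the orbit map, an element of `𝔥 · E` corresponds to an
invariant derivation of `E ⊗ A`. The bracket and the `p`-th power of invariant derivations are
derivations again, and composing them with `ε` gives the elements of `E ⊗ 𝔥` that are needed
(`exists_mem_lieE`).

*Schemes.* The coordinate ring of `H × Spec k(X)` is local, and its closed point is mapped to the
generic point by the action, so the action restricts to `Spec k(X)`; the axioms hold since the
inclusion of the generic point is a monomorphism. For every `k`-algebra `R`, the inclusion of
`Spec(R ⊗ k(X))` in `Spec(R) × X` is a flat base change of the inclusion of the generic point and
hence scheme-theoretically dominant. So an automorphism of `Spec(R) × X` is determined by its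
restriction to the generic point, which proves faithfulness, and a rational function is invariant
as soon as it is invariant at the generic point, which identifies `k(Y)` with `E`.
-/

noncomputable section

namespace HeightOneAction

/-! ### Truncated coordinates and dual derivations -/

section Coordinates

open MvPolynomial

variable {K R ι : Type*} [Field K] [CommRing R] [Algebra K R]

lemma derivation_aeval [DecidableEq ι] (y : ι → R) (d : Derivation K R R) (i : ι)
    (h : ∀ j, d (y j) = if i = j then 1 else 0) (P : MvPolynomial ι K) :
    d (aeval y P) = aeval y (pderiv i P) := by
  induction P using MvPolynomial.induction_on with
  | C a => simp
  | add P Q hP hQ => simp [hP, hQ]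
  | mul_X P j hP =>
    simp only [map_mul, aeval_X, Derivation.leibniz, h, smul_eq_mul, hP, pderiv_X, map_add,
      Pi.single_apply]
    rcases eq_or_ne i j with rfl | hij
    · simp [mul_comm]
    · simp [hij, hij.symm, mul_comm]

/-- If all exponents of a polynomial are smaller than the characteristic and its partial derivative
in one variable vanishes, then this variable does not occur. -/
lemma apply_eq_zero_of_pderiv_eq_zero (p : ℕ) [CharP K p] (P : MvPolynomial ι K)
    (hP : ∀ s ∈ P.support, ∀ i, s i < p) {i : ι} (hi : pderiv i P = 0) :
    ∀ s ∈ P.support, s i = 0 := by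
  intro s hs
  by_contra hne
  have h3 := coeff_pderiv (i := i) P (s - Finsupp.single i 1)
  have h4 : s - Finsupp.single i 1 + Finsupp.single i 1 = s :=
    tsub_add_cancel_of_le (by simpa [Nat.one_le_iff_ne_zero] using hne)
  have h5 : ((s - Finsupp.single i 1 : ι →₀ ℕ) i : K) + 1 = (s i : K) := by
    have : (s - Finsupp.single i 1 : ι →₀ ℕ) i + 1 = s i := by
      simp only [Finsupp.tsub_apply, Finsupp.single_eq_same]; omega
    rw [← this]; push_cast; rfl
  rw [hi, h4, h5, coeff_zero] at h3
  -- The exponent `s i` is positive and smaller than `p`, so it is invertible in `K`.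
  rcases mul_eq_zero.1 h3.symm with h6 | h6
  · exact mem_support_iff.1 hs h6
  · exact Nat.not_dvd_of_pos_of_lt (Nat.pos_of_ne_zero hne) (hP s hs i)
      ((CharP.cast_eq_zero_iff K p _).1 h6)

/-- If `dᵢ yⱼ = δᵢⱼ`, the elements `yⱼ` satisfy no polynomial relation whose exponents are all
smaller than the characteristic: differentiating a relation lowers its degree. -/
lemma eq_zero_of_aeval_eq_zero [DecidableEq ι] (p : ℕ) [CharP K p] [Nontrivial R]
    (y : ι → R) (d : ι → Derivation K R R) (h : ∀ i j, d i (y j) = if i = j then 1 else 0)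
    (P : MvPolynomial ι K) (hP : ∀ s ∈ P.support, ∀ i, s i < p) (h0 : aeval y P = 0) :
    P = 0 := by
  obtain ⟨n, hn⟩ : ∃ n, ∀ s ∈ P.support, Finsupp.degree s < n :=
    ⟨P.support.sup Finsupp.degree + 1, fun s hs => Nat.lt_succ_of_le (Finset.le_sup hs)⟩
  induction n generalizing P with
  | zero =>
    ext s
    by_contra hs
    exact absurd (hn s (mem_support_iff.2 (by simpa using hs))) (by simp)
  | succ n ih =>
    have key : ∀ i, pderiv i P = 0 := by
      intro i
      have hs : ∀ s ∈ (pderiv i P).support, s + Finsupp.single i 1 ∈ P.support := by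
        intro s hs
        rw [mem_support_iff, coeff_pderiv] at hs
        exact mem_support_iff.2 (left_ne_zero_of_mul hs)
      refine ih _ (fun s hs' j => ?_) ?_ (fun s hs' => ?_)
      · have := hP _ (hs s hs') j
        simp only [Finsupp.add_apply] at this
        omega
      · rw [← derivation_aeval y (d i) i (h i), h0, map_zero]
      · have := hn _ (hs s hs')
        simpa using this
    have hc : P = C (coeff 0 P) := by
      ext m
      rw [coeff_C]
      split_ifs with hm
      · rw [hm]
      · by_contra hne
        refine hm (Finsupp.ext fun i => ?_)
        exact (apply_eq_zero_of_pderiv_eq_zero p P hP (key i) m (mem_support_iff.2 hne)).symm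
    rw [hc, aeval_C] at h0
    rw [hc, (FaithfulSMul.algebraMap_injective K R) (by rw [h0, map_zero] :
      algebraMap K R (coeff 0 P) = algebraMap K R 0), C_0]

/-- If `yᵢ ^ p = 0` then every polynomial expression in the `yᵢ` can be written with exponents
smaller than `p`. -/
lemma exists_aeval_eq_of_mem_adjoin (p : ℕ) [Fact p.Prime] (y : ι → R) (hy : ∀ i, y i ^ p = 0)
    {c : R} (hc : c ∈ Algebra.adjoin K (Set.range y)) :
    ∃ P : MvPolynomial ι K, (∀ s ∈ P.support, ∀ i, s i < p) ∧ aeval y P = c := by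
  rw [Algebra.adjoin_range_eq_range_aeval] at hc
  obtain ⟨Q, rfl⟩ := hc
  induction Q using MvPolynomial.induction_on' with
  | monomial s a =>
    by_cases hs : ∀ i, s i < p
    · refine ⟨monomial s a, fun t ht => ?_, rfl⟩
      rwa [Finset.mem_singleton.1 (support_monomial_subset ht)]
    · push Not at hs
      obtain ⟨i, hi⟩ := hs
      -- A monomial with an exponent `≥ p` vanishes.
      refine ⟨0, by simp, ?_⟩
      change aeval y 0 = aeval y (monomial s a)
      classical
      rw [map_zero, aeval_monomial, Finsupp.prod, ← Finset.mul_prod_erase s.support _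
        (a := i), ← Nat.sub_add_cancel hi, pow_add, hy]
      · simp
      · by_contra hcon
        have hi0 : s i = 0 := by simpa using hcon
        have := (Fact.out : p.Prime).pos
        omega
  | add Q Q' hQ hR =>
    classical
    obtain ⟨P, hP, hP'⟩ := hQ
    obtain ⟨P', hQ, hQ'⟩ := hR
    refine ⟨P + P', fun s hs i => ?_, ?_⟩
    · rcases Finset.mem_union.1 (support_add hs) with h | h
      · exact hP s h i
      · exact hQ s h i
    · change aeval y (P + P') = aeval y (Q + Q')
      rw [map_add, map_add]
      exact congrArg₂ _ hP' hQ'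

/-- An element killed by the partial derivatives outside a set of coordinates is a polynomial in
these coordinates. -/
lemma mem_adjoin_image_of_derivation_eq_zero [DecidableEq ι] (p : ℕ) [Fact p.Prime] [CharP K p]
    [Nontrivial R] (y : ι → R) (hy : ∀ i, y i ^ p = 0)
    (d : ι → Derivation K R R) (h : ∀ i j, d i (y j) = if i = j then 1 else 0)
    (hgen : Algebra.adjoin K (Set.range y) = ⊤) (S : Set ι) (b : R) (hb : ∀ i ∉ S, d i b = 0) :
    b ∈ Algebra.adjoin K (y '' S) := by
  obtain ⟨P, hP, rfl⟩ := exists_aeval_eq_of_mem_adjoin (K := K) p y hy (c := b)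
    (by rw [hgen]; trivial)
  have h1 : ∀ i ∉ S, pderiv i P = 0 := by
    intro i hi
    refine eq_zero_of_aeval_eq_zero p y d h _ (fun s hs j => ?_) ?_
    · rw [mem_support_iff, coeff_pderiv] at hs
      have := hP _ (mem_support_iff.2 (left_ne_zero_of_mul hs)) j
      simp only [Finsupp.add_apply] at this
      omega
    · rw [← derivation_aeval y (d i) i (h i), hb i hi]
  have h2 : P ∈ supported K S := by
    rw [mem_supported]
    intro i hi
    by_contra hiS
    obtain ⟨s, hs, his⟩ := (mem_vars_iff_mem_support i).1 hi
    exact (Finsupp.mem_support_iff.1 his) (apply_eq_zero_of_pderiv_eq_zero p P hP (h1 i hiS) s hs)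
  have h3 : aeval y P ∈ (supported K S).map (aeval y) := ⟨P, h2, rfl⟩
  rw [supported_eq_adjoin_X, AlgHom.map_adjoin, ← Set.image_comp] at h3
  convert h3 using 3
  exact (aeval_X y _).symm

variable [Fintype ι]

/-- The monomial in the elements `yᵢ` with exponents smaller than `p`. -/
def truncMonomial (p : ℕ) (y : ι → R) (a : ι → Fin p) : R := ∏ i, y i ^ (a i : ℕ)

lemma truncMonomial_eq_aeval (p : ℕ) (y : ι → R) (a : ι → Fin p) :
    truncMonomial p y a =
      aeval y (monomial (Finsupp.equivFunOnFinite.symm fun i => (a i : ℕ)) (1 : K)) := by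
  rw [aeval_monomial, map_one, one_mul, Finsupp.prod_fintype _ _ (by simp)]
  rfl

lemma linearIndependent_truncMonomial [DecidableEq ι] (p : ℕ) [CharP K p] [Nontrivial R]
    (y : ι → R) (d : ι → Derivation K R R) (h : ∀ i j, d i (y j) = if i = j then 1 else 0) :
    LinearIndependent K (truncMonomial p y) := by
  have hinj : Function.Injective fun a : ι → Fin p =>
      (Finsupp.equivFunOnFinite.symm fun i => (a i : ℕ) : ι →₀ ℕ) := fun a b hab => by
    funext i
    exact Fin.ext (DFunLike.congr_fun hab i)
  have h1 := (basisMonomials ι K).linearIndependent.comp _ hinj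
  have h2 : truncMonomial p y = (aeval (R := K) y).toLinearMap ∘
      ((basisMonomials ι K) ∘ fun a : ι → Fin p =>
        (Finsupp.equivFunOnFinite.symm fun i => (a i : ℕ) : ι →₀ ℕ)) := by
    funext a
    simp [truncMonomial_eq_aeval (K := K)]
  rw [h2]
  refine h1.map (Submodule.disjoint_def.2 fun P hP hP0 => ?_)
  refine eq_zero_of_aeval_eq_zero p y d h P (fun s hs i => ?_) hP0
  have hle : Submodule.span K (Set.range ((basisMonomials ι K) ∘ fun a : ι → Fin p =>
        (Finsupp.equivFunOnFinite.symm fun i => (a i : ℕ) : ι →₀ ℕ))) ≤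
      restrictSupport K {s | ∀ i, s i < p} := by
    rw [Submodule.span_le]
    rintro _ ⟨a, rfl⟩
    rw [SetLike.mem_coe, mem_restrictSupport_iff]
    intro t ht
    simp only [Function.comp_apply, coe_basisMonomials] at ht
    rw [Finset.mem_singleton.1 (support_monomial_subset ht)]
    exact fun i => (a i).2
  have := (mem_restrictSupport_iff ..).1 (hle hP)
  exact this hs i

lemma span_truncMonomial (p : ℕ) [Fact p.Prime] (y : ι → R) (hy : ∀ i, y i ^ p = 0) :
    Submodule.span K (Set.range (truncMonomial p y)) =
      Subalgebra.toSubmodule (Algebra.adjoin K (Set.range y)) := by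
  apply le_antisymm
  · rw [Submodule.span_le]
    rintro _ ⟨a, rfl⟩
    exact Subalgebra.prod_mem _ fun i _ =>
      Subalgebra.pow_mem _ (Algebra.subset_adjoin (Set.mem_range_self i)) _
  · intro c hc
    obtain ⟨P, hP, rfl⟩ := exists_aeval_eq_of_mem_adjoin p y hy hc
    rw [P.as_sum, map_sum]
    refine Submodule.sum_mem _ fun s hs => ?_
    have h1 : aeval y (monomial s (coeff s P)) =
        coeff s P • truncMonomial p y (fun i => ⟨s i, hP s hs i⟩) := by
      rw [aeval_monomial, Finsupp.prod_fintype _ _ (by simp), Algebra.smul_def]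
      rfl
    rw [h1]
    exact Submodule.smul_mem _ _ (Submodule.subset_span (Set.mem_range_self _))

lemma finrank_adjoin_eq_pow [DecidableEq ι] (p : ℕ) [Fact p.Prime] [CharP K p] [Nontrivial R]
    (y : ι → R) (hy : ∀ i, y i ^ p = 0)
    (d : ι → Derivation K R R) (h : ∀ i j, d i (y j) = if i = j then 1 else 0) :
    Module.finrank K (Algebra.adjoin K (Set.range y)) = p ^ Fintype.card ι := by
  have h1 := finrank_span_eq_card (linearIndependent_truncMonomial p y d h)
  rw [span_truncMonomial p y hy] at h1
  simpa using h1

lemma finrank_eq_pow [DecidableEq ι] (p : ℕ) [Fact p.Prime] [CharP K p] [Nontrivial R]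
    (y : ι → R) (hy : ∀ i, y i ^ p = 0)
    (d : ι → Derivation K R R) (h : ∀ i j, d i (y j) = if i = j then 1 else 0)
    (hgen : Algebra.adjoin K (Set.range y) = ⊤) :
    Module.finrank K R = p ^ Fintype.card ι := by
  rw [← finrank_adjoin_eq_pow p y hy d h, hgen]
  exact (Subalgebra.topEquiv.toLinearEquiv.finrank_eq).symm

/-- An algebra with truncated coordinates is finite and free over the subalgebra generated by some
of the coordinates: the monomials in the remaining coordinates generate it as a module, and the
dimensions over the ground field show that they are a basis. -/
lemma free_of_range_eq_adjoin {σ τ B : Type*} [Fintype σ] [Fintype τ] [DecidableEq σ]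
    [DecidableEq τ] [CommRing B] [Algebra K B] [Algebra B R] [IsScalarTower K B R]
    (p : ℕ) [Fact p.Prime] [CharP K p] [Nontrivial R]
    (y : σ ⊕ τ → R) (hy : ∀ i, y i ^ p = 0)
    (d : σ ⊕ τ → Derivation K R R) (h : ∀ i j, d i (y j) = if i = j then 1 else 0)
    (hgen : Algebra.adjoin K (Set.range y) = ⊤)
    (hinj : Function.Injective (algebraMap B R))
    (hrange : (IsScalarTower.toAlgHom K B R).range =
      Algebra.adjoin K (Set.range fun i => y (Sum.inl i))) :
    Module.finrank K B = p ^ Fintype.card σ ∧ Module.Free B R ∧ Module.Finite B R := by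
  have hp := (Fact.out : p.Prime).pos
  have hB : Module.finrank K B = p ^ Fintype.card σ := by
    rw [← finrank_adjoin_eq_pow p (fun i => y (Sum.inl i)) (fun i => hy _)
      (fun i => d (Sum.inl i)) (fun i j => by simp [h]), ← hrange]
    exact (AlgEquiv.ofInjective (IsScalarTower.toAlgHom K B R) hinj).toLinearEquiv.finrank_eq
  have hR := finrank_eq_pow p y hy d h hgen
  have : Module.Finite K B := Module.finite_of_finrank_pos (by rw [hB]; positivity)
  have : Module.Finite K R := Module.finite_of_finrank_pos (by rw [hR]; positivity)
  let φ := Fintype.linearCombination B (truncMonomial p fun i => y (Sum.inr i))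
  have hsurj : Function.Surjective φ := by
    have h1 : Submodule.span K (Set.range (truncMonomial p y)) ≤
        (LinearMap.range φ).restrictScalars K := by
      rw [Submodule.span_le]
      rintro _ ⟨a, rfl⟩
      obtain ⟨b, hb⟩ : truncMonomial p (fun i => y (Sum.inl i)) (fun i => a (Sum.inl i)) ∈
          (IsScalarTower.toAlgHom K B R).range := by
        rw [hrange]
        exact Subalgebra.prod_mem _ fun i _ =>
          Subalgebra.pow_mem _ (Algebra.subset_adjoin (Set.mem_range_self i)) _
      refine ⟨Pi.single (fun i => a (Sum.inr i)) b, ?_⟩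
      change Fintype.linearCombination B _ _ = _
      rw [Fintype.linearCombination_apply_single, Algebra.smul_def, truncMonomial, truncMonomial,
        Fintype.prod_sum_type]
      exact congrArg (· * _) hb
    rw [span_truncMonomial p y hy, hgen] at h1
    exact fun r => h1 trivial
  have hbij : Function.Bijective φ := by
    refine ⟨?_, hsurj⟩
    refine (LinearMap.injective_iff_surjective_of_finrank_eq_finrank
      (f := φ.restrictScalars K) ?_).2 hsurj
    rw [Module.finrank_pi_fintype, hR]
    simp [hB, pow_add, mul_comm]
  let e := LinearEquiv.ofBijective φ hbij
  exact ⟨hB, Module.Free.of_equiv e, Module.Finite.equiv e⟩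

/-- If `Xᵢ` are derivations of an augmented algebra with nil augmentation ideal, and `Xᵢ yⱼ`
reduces to `δᵢⱼ`, then suitable combinations of the `Xᵢ` are dual to the `yⱼ`: the matrix of the
`Xᵢ yⱼ` is invertible, since it reduces to the unit matrix. -/
lemma exists_dual_derivations [DecidableEq ι] (ε : R →ₐ[K] K)
    (hε : ∀ r, ε r = 0 → IsNilpotent r) (y : ι → R) (X : ι → Derivation K R R)
    (h : ∀ i j, ε (X i (y j)) = if i = j then 1 else 0) :
    ∃ N : Matrix ι ι R, ∀ i j, (∑ l, N i l • X l) (y j) = if i = j then 1 else 0 := by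
  let M : Matrix ι ι R := Matrix.of fun i j => X i (y j)
  have h1 : ε.mapMatrix M = 1 := by
    ext i j
    simp [M, h, Matrix.one_apply]
  have h2 : ε M.det = 1 := by
    rw [AlgHom.map_det, h1, Matrix.det_one]
  have h3 : IsUnit M.det := by
    have h4 : IsNilpotent (1 - M.det) := hε _ (by simp [h2])
    simpa using h4.isUnit_one_sub
  refine ⟨M⁻¹, fun i j => ?_⟩
  have h5 := congrFun (congrFun (Matrix.nonsing_inv_mul M h3) i) j
  rw [Matrix.one_apply, Matrix.mul_apply] at h5
  rw [← h5, ← Derivation.coeFnAddMonoidHom_apply, map_sum, Finset.sum_apply]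
  simp [M]

end Coordinates

/-! ### Point derivations -/

section PointDerivations

variable {K R ι : Type*} [Field K] [CommRing R] [Algebra K R] (ε : R →ₐ[K] K)

/-- The tangent space at a rational point: the linear forms that are derivations at the point. -/
def pointDerivations : Submodule K (R →ₗ[K] K) where
  carrier := {D | ∀ a b : R, D (a * b) = ε a * D b + ε b * D a}
  add_mem' := by
    intro D D' h h' a b
    simp only [LinearMap.add_apply, h a b, h' a b]
    ring
  zero_mem' := by intro a b; simp
  smul_mem' := by
    intro c D h a b
    simp only [LinearMap.smul_apply, h a b, smul_eq_mul]
    ring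

lemma pointDerivations_map_one {D : R →ₗ[K] K} (hD : D ∈ pointDerivations ε) : D 1 = 0 := by
  simpa using hD 1 1

/-- Linearly independent point derivations admit dual functions that vanish at the point. -/
lemma exists_dual_functions [Fintype ι] [DecidableEq ι] (D : ι → R →ₗ[K] K)
    (hD : ∀ i, D i ∈ pointDerivations ε) (hli : LinearIndependent K D) :
    ∃ y : ι → R, (∀ i, ε (y i) = 0) ∧ ∀ i j, D i (y j) = if i = j then 1 else 0 := by
  have hsurj : Function.Surjective (LinearMap.pi D) := by
    by_contra hns
    rw [← LinearMap.range_eq_top] at hns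
    obtain ⟨f, hf0, hf⟩ := Submodule.exists_le_ker_of_lt_top _ (lt_top_iff_ne_top.2 hns)
    refine hf0 ?_
    have h1 : ∑ i, f (Pi.single i 1) • D i = 0 := by
      ext r
      have h2 : f (LinearMap.pi D r) = 0 := hf ⟨r, rfl⟩
      have h3 : LinearMap.pi D r = ∑ i, D i r • (Pi.single i 1 : ι → K) := by
        ext j
        simp [Pi.single_apply]
      rw [h3, map_sum] at h2
      simpa [mul_comm] using h2
    have h3 := Fintype.linearIndependent_iff.1 hli _ h1
    exact LinearMap.pi_ext' fun i => LinearMap.ext_ring (by simpa using h3 i)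
  choose y hy using fun j => hsurj (Pi.single j 1)
  refine ⟨fun j => y j - algebraMap K R (ε (y j)), fun j => by simp, fun i j => ?_⟩
  have h4 := congrFun (hy j) i
  rw [map_sub, Algebra.algebraMap_eq_smul_one, map_smul, pointDerivations_map_one ε (hD i)]
  simpa [Pi.single_apply] using h4

/-- Modulo the square of the maximal ideal, a function is determined by its value and its
derivatives. -/
lemma sub_sum_mem_ker_sq [Fintype ι] [DecidableEq ι] (D : ι → R →ₗ[K] K)
    (hD : ∀ i, D i ∈ pointDerivations ε)
    (hspan : pointDerivations ε ≤ Submodule.span K (Set.range D)) (y : ι → R)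
    (hy : ∀ i, ε (y i) = 0) (hDy : ∀ i j, D i (y j) = if i = j then 1 else 0) (z : R) :
    z - algebraMap K R (ε z) - ∑ i, D i z • y i ∈ RingHom.ker ε ^ 2 := by
  set w := z - algebraMap K R (ε z) - ∑ i, D i z • y i with hw
  have hεw : ε w = 0 := by simp [hw, hy]
  have hDw : ∀ i, D i w = 0 := fun i => by
    simp [hw, hDy, Algebra.algebraMap_eq_smul_one, pointDerivations_map_one ε (hD i)]
  let Q : Submodule K R := Submodule.span K {1} ⊔ (RingHom.ker ε ^ 2).restrictScalars K
  -- A linear form that vanishes on `Q` is a point derivation, hence vanishes at `w`.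
  have hwQ : w ∈ Q := by
    by_contra hwQ
    obtain ⟨f, hfw, hf⟩ := Submodule.exists_le_ker_of_notMem hwQ
    have hf1 : f 1 = 0 := hf (Submodule.mem_sup_left (Submodule.mem_span_singleton_self 1))
    have hf2 : ∀ a b, ε a = 0 → ε b = 0 → f (a * b) = 0 := fun a b ha hb => by
      refine hf (Submodule.mem_sup_right ?_)
      rw [Submodule.restrictScalars_mem, pow_two]
      exact Ideal.mul_mem_mul ha hb
    have hfD : f ∈ pointDerivations ε := by
      intro a b
      have h1 := hf2 (a - algebraMap K R (ε a)) (b - algebraMap K R (ε b)) (by simp) (by simp)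
      have h2 : (a - algebraMap K R (ε a)) * (b - algebraMap K R (ε b)) =
          a * b - ε b • a - ε a • b + (ε a * ε b) • 1 := by
        simp only [Algebra.smul_def, map_mul]
        ring
      rw [h2, map_add, map_sub, map_sub, map_smul, map_smul, map_smul, hf1] at h1
      simp only [smul_eq_mul, mul_zero] at h1
      linear_combination h1
    have hle : Submodule.span K (Set.range D) ≤
        LinearMap.ker (LinearMap.applyₗ (R := K) (M₂ := K) w) := by
      rw [Submodule.span_le]
      rintro _ ⟨i, rfl⟩
      exact hDw i
    exact hfw (hle (hspan hfD))
  obtain ⟨c, hc, s, hs, hcs⟩ := Submodule.mem_sup.1 hwQ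
  obtain ⟨c, rfl⟩ := Submodule.mem_span_singleton.1 hc
  have hεs : ε s = 0 := Ideal.pow_le_self two_ne_zero hs
  have hc0 : c = 0 := by
    have := congrArg ε hcs
    simpa [hεs, hεw] using this
  rw [← hcs, hc0, zero_smul, zero_add]
  exact hs

/-- If the maximal ideal at the point is nilpotent, then functions that are dual to the point
derivations generate the algebra. -/
lemma adjoin_eq_top_of_dual [Fintype ι] [DecidableEq ι] (D : ι → R →ₗ[K] K)
    (hD : ∀ i, D i ∈ pointDerivations ε)
    (hspan : pointDerivations ε ≤ Submodule.span K (Set.range D)) (y : ι → R)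
    (hy : ∀ i, ε (y i) = 0) (hDy : ∀ i j, D i (y j) = if i = j then 1 else 0)
    (hnil : IsNilpotent (RingHom.ker ε)) : Algebra.adjoin K (Set.range y) = ⊤ := by
  set S := Algebra.adjoin K (Set.range y) with hS
  have hyS : ∀ i, y i ∈ S := fun i => Algebra.subset_adjoin (Set.mem_range_self i)
  have h2 : ∀ z, ∃ s ∈ S, z - s ∈ RingHom.ker ε ^ 2 := fun z =>
    ⟨algebraMap K R (ε z) + ∑ i, D i z • y i, S.add_mem (S.algebraMap_mem _)
      (S.sum_mem fun i _ => S.smul_mem (hyS i) _), by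
      rw [← sub_sub]
      exact sub_sum_mem_ker_sq ε D hD hspan y hy hDy z⟩
  -- `S` contains representatives for all graded pieces of the `ker ε`-adic filtration.
  have h3 : ∀ n, ∀ z ∈ RingHom.ker ε ^ n, ∃ s ∈ S, s ∈ RingHom.ker ε ^ n ∧
      z - s ∈ RingHom.ker ε ^ (n + 1) := by
    intro n
    induction n with
    | zero =>
      intro z _
      obtain ⟨s, hs, hzs⟩ := h2 z
      exact ⟨s, hs, by simp, Ideal.pow_le_pow_right (by omega) hzs⟩
    | succ n ih =>
      intro z hz
      rw [pow_succ] at hz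
      refine Submodule.mul_induction_on hz (fun a ha b hb => ?_) (fun a b ha hb => ?_)
      · obtain ⟨s, hs, hsn, has⟩ := ih a ha
        obtain ⟨t, ht, hbt⟩ := h2 b
        have ht1 : t ∈ RingHom.ker ε := by
          have := Ideal.sub_mem _ hb (Ideal.pow_le_self two_ne_zero hbt)
          simpa using this
        refine ⟨s * t, S.mul_mem hs ht, ?_, ?_⟩
        · rw [pow_succ]
          exact Ideal.mul_mem_mul hsn ht1
        · have : a * b - s * t = (a - s) * b + s * (b - t) := by ring
          rw [this]
          refine Ideal.add_mem _ ?_ ?_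
          · rw [pow_succ]
            exact Ideal.mul_mem_mul has hb
          · have := Ideal.mul_mem_mul hsn hbt
            rwa [← pow_add] at this
      · obtain ⟨s, hs, hsn, has⟩ := ha
        obtain ⟨t, ht, htn, hbt⟩ := hb
        refine ⟨s + t, S.add_mem hs ht, Ideal.add_mem _ hsn htn, ?_⟩
        rw [add_sub_add_comm]
        exact Ideal.add_mem _ has hbt
  obtain ⟨N, hN⟩ := hnil
  rw [eq_top_iff]
  intro z _
  have h4 : ∀ n, ∃ s ∈ S, z - s ∈ RingHom.ker ε ^ n := by
    intro n
    induction n with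
    | zero => exact ⟨0, S.zero_mem, by simp⟩
    | succ n ih =>
      obtain ⟨s, hs, hzs⟩ := ih
      obtain ⟨t, ht, -, hzt⟩ := h3 n _ hzs
      exact ⟨s + t, S.add_mem hs ht, by rwa [← sub_sub]⟩
  obtain ⟨s, hs, hzs⟩ := h4 N
  rw [hN, Ideal.zero_eq_bot, Ideal.mem_bot, sub_eq_zero] at hzs
  rw [hzs]
  exact hs

end PointDerivations

/-! ### Height-one Hopf algebras and their Lie algebras -/

section HeightOne

variable {p : ℕ} [Fact p.Prime] {k A : Type u} [Field k] [CommRing A] [HopfAlgebra k A]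

lemma IsHeightOne.pow_eq_zero (hA : IsHeightOne p k A) {a : A}
    (ha : Coalgebra.counit (R := k) a = 0) : a ^ p = 0 := by
  rw [hA.frobenius_trivial, ha, zero_pow (Fact.out : p.Prime).ne_zero, map_zero]

lemma IsHeightOne.finite (hA : IsHeightOne p k A) : Module.Finite k A := by
  have := hA.finiteType
  have : Algebra.IsIntegral k A := ⟨fun a =>
    IsIntegral.of_pow (Fact.out : p.Prime).pos (by
      rw [hA.frobenius_trivial]
      exact isIntegral_algebraMap)⟩
  exact Algebra.IsIntegral.finite

variable [CharP k p]

variable (k A) in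
/-- The augmentation of the base change `L ⊗ A`. -/
def augmentation (L : Type u) [CommRing L] [Algebra k L] : L ⊗[k] A →ₐ[L] L :=
  Algebra.TensorProduct.lift (AlgHom.id L L)
    ((Algebra.ofId k L).comp (Bialgebra.counitAlgHom k A)) fun _ _ => Commute.all _ _

@[simp]
lemma augmentation_tmul (L : Type u) [CommRing L] [Algebra k L] (c : L) (a : A) :
    augmentation k A L (c ⊗ₜ a) = c * algebraMap k L (Coalgebra.counit (R := k) a) := by
  simp [augmentation, Algebra.ofId_apply]

/-- The Frobenius of `L ⊗ A` factors over the augmentation. -/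
lemma IsHeightOne.pow_eq_augmentation (hA : IsHeightOne p k A) (L : Type u) [CommRing L]
    [Algebra k L] (x : L ⊗[k] A) :
    x ^ p = algebraMap L (L ⊗[k] A) (augmentation k A L x ^ p) := by
  rcases subsingleton_or_nontrivial L with hL | hL
  · have : Subsingleton (L ⊗[k] A) := Module.subsingleton L _
    exact Subsingleton.elim _ _
  have hLp : CharP L p := charP_of_injective_algebraMap (algebraMap k L).injective p
  rcases subsingleton_or_nontrivial (L ⊗[k] A) with hL | hL
  · exact Subsingleton.elim _ _
  have : CharP (L ⊗[k] A) p := charP_of_injective_algebraMap (algebraMap k (L ⊗[k] A)).injective p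
  induction x using TensorProduct.induction_on with
  | zero => simp [(Fact.out : p.Prime).ne_zero]
  | tmul c a =>
    rw [Algebra.TensorProduct.tmul_pow, hA.frobenius_trivial, augmentation_tmul, mul_pow,
      ← map_pow (algebraMap k L), Algebra.algebraMap_eq_smul_one, ← TensorProduct.smul_tmul,
      Algebra.TensorProduct.algebraMap_apply, Algebra.smul_def, mul_comm, Algebra.algebraMap_self,
      RingHom.id_apply]
  | add x y hx hy => rw [add_pow_char, hx, hy, map_add, add_pow_char, map_add]

lemma IsHeightOne.isNilpotent_ker_augmentation (hA : IsHeightOne p k A) (L : Type u) [Field L]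
    [Algebra k L] : IsNilpotent (RingHom.ker (augmentation k A L)) := by
  have := hA.finite
  have : IsNoetherianRing (L ⊗[k] A) := IsNoetherianRing.of_finite L _
  rw [Ideal.FG.isNilpotent_iff_le_nilradical (IsNoetherian.noetherian _)]
  intro x hx
  refine ⟨p, ?_⟩
  rw [hA.pow_eq_augmentation, (RingHom.mem_ker).1 hx, zero_pow (Fact.out : p.Prime).ne_zero,
    map_zero]
  exact Submodule.zero_mem _

end HeightOne

/-! ### Invariant derivations -/

section InvariantDerivations

variable {k A : Type u} [Field k] [CommRing A]

/-- The base change of a derivation. -/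
def derivationBaseChange (L : Type u) [CommRing L] [Algebra k L] [Algebra k A] :
    Derivation k A A →ₗ[k] Derivation L (L ⊗[k] A) (L ⊗[k] A) where
  toFun d := Derivation.mk' (d.toLinearMap.baseChange L) (by
    intro x y
    induction x using TensorProduct.induction_on with
    | zero => simp
    | add x x' hx hx' => simp only [add_mul, map_add, hx, hx', add_smul, smul_add]; abel
    | tmul c a =>
      induction y using TensorProduct.induction_on with
      | zero => simp
      | add y y' hy hy' => simp only [mul_add, map_add, hy, hy', add_smul, smul_add]; abel
      | tmul c' b =>
        simp [TensorProduct.tmul_add, mul_comm c' c])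
  map_add' d d' := by
    ext x
    exact LinearMap.congr_fun (LinearMap.baseChange_add d.toLinearMap d'.toLinearMap) x
  map_smul' c d := by
    ext x
    exact LinearMap.congr_fun (LinearMap.baseChange_smul c d.toLinearMap) x

@[simp]
lemma derivationBaseChange_tmul (L : Type u) [CommRing L] [Algebra k L] [Algebra k A]
    (d : Derivation k A A) (c : L) (a : A) :
    derivationBaseChange L d (c ⊗ₜ a) = c ⊗ₜ d a := rfl

variable [HopfAlgebra k A]

lemma lie_mem_pointDerivations (D : Lie k A) :
    D.1 ∈ pointDerivations (Bialgebra.counitAlgHom k A) := D.2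

lemma lie_map_one (D : Lie k A) : D.1 1 = 0 :=
  pointDerivations_map_one _ (lie_mem_pointDerivations D)

variable (k A) in
/-- The action of `H` on itself by multiplication. -/
def regularAction : Action (k := k) (A := A) A where
  coact := Bialgebra.comulAlgHom k A
  counit_coact a := by
    have h := Coalgebra.rTensor_counit_comul (R := k) a
    have h2 : Algebra.TensorProduct.map (Bialgebra.counitAlgHom k A) (AlgHom.id k A)
        (Bialgebra.comulAlgHom k A a) = 1 ⊗ₜ[k] a := h
    rw [h2]
    simp
  comul_coact a := Coalgebra.coassoc_apply (R := k) a

/-- The derivation `(D ⊗ id) ∘ Δ` of the coordinate ring given by an element of the Lie algebra. -/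
def leftDerivation : Lie k A →ₗ[k] Derivation k A A := (regularAction k A).derivation

lemma leftDerivation_apply (D : Lie k A) (a : A) :
    leftDerivation D a = TensorProduct.lid k A (D.1.rTensor A (Coalgebra.comul a)) := rfl

/-- The derivation `(id ⊗ D) ∘ Δ` of the coordinate ring given by an element of the Lie algebra. -/
def rightDerivation : Lie k A →ₗ[k] Derivation k A A where
  toFun D := Derivation.mk'
    ((TensorProduct.rid k A).toLinearMap ∘ₗ D.1.lTensor A ∘ₗ Coalgebra.comul) (by
      have key : ∀ x y : A ⊗[k] A, TensorProduct.rid k A (D.1.lTensor A (x * y)) =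
          TensorProduct.rid k A ((Coalgebra.counit (R := k)).lTensor A x) *
              TensorProduct.rid k A (D.1.lTensor A y) +
          TensorProduct.rid k A ((Coalgebra.counit (R := k)).lTensor A y) *
              TensorProduct.rid k A (D.1.lTensor A x) := by
        intro x y
        induction x using TensorProduct.induction_on with
        | zero => simp
        | add x x' hx hx' => simp only [add_mul, map_add, hx, hx', mul_add]; ring
        | tmul a c =>
          induction y using TensorProduct.induction_on with
          | zero => simp
          | add y y' hy hy' => simp only [mul_add, map_add, hy, hy', add_mul]; ring
          | tmul b d =>
            have h := D.2 c d
            simp only [Algebra.algebraMap_self, RingHom.id_apply] at h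
            simp only [Algebra.TensorProduct.tmul_mul_tmul, LinearMap.lTensor_tmul, h,
              TensorProduct.rid_tmul, Algebra.smul_def, map_add, map_mul]
            ring
      intro a b
      have h := fun a : A => Coalgebra.lTensor_counit_comul (R := k) a
      simp only [LinearMap.comp_apply, Bialgebra.comul_mul, LinearEquiv.coe_coe, key, h,
        TensorProduct.rid_tmul, one_smul, smul_eq_mul])
  map_add' D D' := by
    ext a
    change TensorProduct.rid k A ((D.1 + D'.1).lTensor A (Coalgebra.comul a)) =
      TensorProduct.rid k A (D.1.lTensor A (Coalgebra.comul a)) +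
        TensorProduct.rid k A (D'.1.lTensor A (Coalgebra.comul a))
    rw [LinearMap.lTensor_add, LinearMap.add_apply, map_add]
  map_smul' c D := by
    ext a
    change TensorProduct.rid k A ((c • D.1).lTensor A (Coalgebra.comul a)) =
      c • TensorProduct.rid k A (D.1.lTensor A (Coalgebra.comul a))
    rw [LinearMap.lTensor_smul, LinearMap.smul_apply, map_smul]

lemma rightDerivation_apply (D : Lie k A) (a : A) :
    rightDerivation D a = TensorProduct.rid k A (D.1.lTensor A (Coalgebra.comul a)) := rfl

lemma counit_leftDerivation (D : Lie k A) (a : A) :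
    Coalgebra.counit (R := k) (leftDerivation D a) = D.1 a := by
  have key : ∀ x : A ⊗[k] A, Coalgebra.counit (R := k)
      (TensorProduct.lid k A (D.1.rTensor A x)) =
        D.1 (TensorProduct.rid k A ((Coalgebra.counit (R := k)).lTensor A x)) := by
    intro x
    induction x using TensorProduct.induction_on with
    | zero => simp
    | add x y hx hy => simp only [map_add, hx, hy]
    | tmul a b => simp [mul_comm]
  rw [leftDerivation_apply, key, Coalgebra.lTensor_counit_comul]
  simp

lemma counit_rightDerivation (D : Lie k A) (a : A) :
    Coalgebra.counit (R := k) (rightDerivation D a) = D.1 a := by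
  have key : ∀ x : A ⊗[k] A, Coalgebra.counit (R := k)
      (TensorProduct.rid k A (D.1.lTensor A x)) =
        D.1 (TensorProduct.lid k A ((Coalgebra.counit (R := k)).rTensor A x)) := by
    intro x
    induction x using TensorProduct.induction_on with
    | zero => simp
    | add x y hx hy => simp only [map_add, hx, hy]
    | tmul a b => simp [mul_comm]
  rw [rightDerivation_apply, key, Coalgebra.rTensor_counit_comul]
  simp

variable (L : Type u) [CommRing L] [Algebra k L]

/-- The `L`-linear extension of `leftDerivation` to the base change. -/
def leftDerivationExt : L ⊗[k] Lie k A →ₗ[L] Derivation L (L ⊗[k] A) (L ⊗[k] A) :=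
  (derivationBaseChange L ∘ₗ leftDerivation).liftBaseChange L

/-- The `L`-linear extension of `rightDerivation` to the base change. -/
def rightDerivationExt : L ⊗[k] Lie k A →ₗ[L] Derivation L (L ⊗[k] A) (L ⊗[k] A) :=
  (derivationBaseChange L ∘ₗ rightDerivation).liftBaseChange L

@[simp]
lemma leftDerivationExt_tmul_tmul (c : L) (D : Lie k A) (e : L) (a : A) :
    leftDerivationExt L (c ⊗ₜ D) (e ⊗ₜ a) = (c * e) ⊗ₜ leftDerivation D a := rfl

@[simp]
lemma rightDerivationExt_tmul_tmul (c : L) (D : Lie k A) (e : L) (a : A) :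
    rightDerivationExt L (c ⊗ₜ D) (e ⊗ₜ a) = (c * e) ⊗ₜ rightDerivation D a := rfl

lemma augmentation_rightDerivationExt (ξ : L ⊗[k] Lie k A) (a : A) :
    augmentation k A L (rightDerivationExt L ξ (1 ⊗ₜ a)) = (lieBaseChange k A L ξ).1 a := by
  induction ξ using TensorProduct.induction_on with
  | zero => simp
  | add x y hx hy => simp [hx, hy]
  | tmul c D => simp [counit_rightDerivation, lieBaseChange, lieExtend]

end InvariantDerivations

/-! ### The coaction and invariant derivations -/

section Coaction

variable {k A F : Type u} [Field k] [CommRing A] [HopfAlgebra k A] [Field F] [Algebra k F]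
  (ρ : Action (k := k) (A := A) F)

namespace Action

/-- The coaction, with values in the coordinate ring of `H_F`. -/
def orbit : F →ₐ[k] F ⊗[k] A :=
  (Algebra.TensorProduct.comm k A F).toAlgHom.comp ρ.coact

lemma orbit_apply (f : F) : ρ.orbit f = Algebra.TensorProduct.comm k A F (ρ.coact f) := rfl

lemma derivation_apply (D : Lie k A) (f : F) :
    ρ.derivation D f = TensorProduct.lid k F (D.1.rTensor F (ρ.coact f)) := rfl

lemma augmentation_orbit (f : F) : augmentation k A F (ρ.orbit f) = f := by
  have key : ∀ x : A ⊗[k] F, augmentation k A F (Algebra.TensorProduct.comm k A F x) =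
      Algebra.TensorProduct.lid k F (Algebra.TensorProduct.map (Bialgebra.counitAlgHom k A)
        (AlgHom.id k F) x) := by
    intro x
    induction x using TensorProduct.induction_on with
    | zero => simp
    | add x y hx hy => simp only [map_add, hx, hy]
    | tmul a f => simp [Algebra.smul_def, mul_comm]
  rw [orbit_apply, key, ρ.counit_coact]

/-- The coaction is equivariant for the translations by the Lie algebra on the side on which the
group acts. -/
lemma rTensor_leftDerivation_coact (D : Lie k A) (f : F) :
    (leftDerivation D).toLinearMap.rTensor F (ρ.coact f) = ρ.coact (ρ.derivation D f) := by
  let Θ : A ⊗[k] (A ⊗[k] F) →ₗ[k] A ⊗[k] F :=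
    (TensorProduct.lid k (A ⊗[k] F)).toLinearMap ∘ₗ D.1.rTensor (A ⊗[k] F)
  have h1 : ∀ x : A ⊗[k] F, Θ (Algebra.TensorProduct.assoc k k k A A F
      (Algebra.TensorProduct.map (Bialgebra.comulAlgHom k A) (AlgHom.id k F) x)) =
      (leftDerivation D).toLinearMap.rTensor F x := by
    intro x
    induction x using TensorProduct.induction_on with
    | zero => simp
    | add x y hx hy => simp only [map_add, hx, hy]
    | tmul a f =>
      simp only [Algebra.TensorProduct.map_tmul, LinearMap.rTensor_tmul, AlgHom.id_apply,
        Derivation.coeFn_coe, leftDerivation_apply,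
        Bialgebra.comulAlgHom_apply]
      induction Coalgebra.comul (R := k) a using TensorProduct.induction_on with
      | zero => simp
      | add x y hx hy => simp only [map_add, TensorProduct.add_tmul, hx, hy]
      | tmul a b => simp [Θ, TensorProduct.smul_tmul']
  have h2 : ∀ x : A ⊗[k] F, Θ (Algebra.TensorProduct.map (AlgHom.id k A) ρ.coact x) =
      ρ.coact (TensorProduct.lid k F (D.1.rTensor F x)) := by
    intro x
    induction x using TensorProduct.induction_on with
    | zero => simp
    | add x y hx hy => simp only [map_add, hx, hy]
    | tmul a f => simp [Θ]
  rw [← h1, ρ.comul_coact, h2, derivation_apply]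

/-- By coassociativity, translating the group element on the other side amounts to moving the
point of `Spec F`. -/
lemma rTensor_rightDerivation_coact (D : Lie k A) (f : F) :
    (rightDerivation D).toLinearMap.rTensor F (ρ.coact f) =
      (ρ.derivation D).toLinearMap.lTensor A (ρ.coact f) := by
  let Θ : A ⊗[k] (A ⊗[k] F) →ₗ[k] A ⊗[k] F :=
    ((TensorProduct.lid k F).toLinearMap ∘ₗ D.1.rTensor F).lTensor A
  have h1 : ∀ x : A ⊗[k] F, Θ (Algebra.TensorProduct.assoc k k k A A F
      (Algebra.TensorProduct.map (Bialgebra.comulAlgHom k A) (AlgHom.id k F) x)) =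
      (rightDerivation D).toLinearMap.rTensor F x := by
    intro x
    induction x using TensorProduct.induction_on with
    | zero => simp
    | add x y hx hy => simp only [map_add, hx, hy]
    | tmul a f =>
      simp only [Algebra.TensorProduct.map_tmul, LinearMap.rTensor_tmul, AlgHom.id_apply,
        Derivation.coeFn_coe, rightDerivation_apply,
        Bialgebra.comulAlgHom_apply]
      induction Coalgebra.comul (R := k) a using TensorProduct.induction_on with
      | zero => simp
      | add x y hx hy => simp only [map_add, TensorProduct.add_tmul, hx, hy]
      | tmul a b => simp [Θ, TensorProduct.smul_tmul]
  have h2 : ∀ x : A ⊗[k] F, Θ (Algebra.TensorProduct.map (AlgHom.id k A) ρ.coact x) =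
      (ρ.derivation D).toLinearMap.lTensor A x := by
    intro x
    induction x using TensorProduct.induction_on with
    | zero => simp
    | add x y hx hy => simp only [map_add, hx, hy]
    | tmul a f => simp [Θ, derivation_apply]
  rw [← h1, ρ.comul_coact, h2]

lemma derivationF_tmul_apply (c : F) (D : Lie k A) (f : F) :
    ρ.derivationF (c ⊗ₜ D) f = c * ρ.derivation D f := rfl

/-- The orbit map intertwines the right translations with the action on `F` itself. -/
lemma rightDerivationExt_orbit (ξ : F ⊗[k] Lie k A) (f : F) :
    rightDerivationExt F ξ (ρ.orbit f) =
      ((ρ.derivationF ξ).toLinearMap.restrictScalars k).rTensor A (ρ.orbit f) := by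
  induction ξ using TensorProduct.induction_on with
  | zero => simp
  | add x y hx hy =>
    rw [map_add, Derivation.add_apply, hx, hy, map_add, ← LinearMap.add_apply,
      ← LinearMap.rTensor_add]
    rfl
  | tmul c D =>
    have h1 : ∀ x : A ⊗[k] F, rightDerivationExt F (c ⊗ₜ D)
        (Algebra.TensorProduct.comm k A F x) =
        c • Algebra.TensorProduct.comm k A F ((rightDerivation D).toLinearMap.rTensor F x) := by
      intro x
      induction x using TensorProduct.induction_on with
      | zero => simp
      | add x y hx hy => simp only [map_add, hx, hy, smul_add]
      | tmul a f => simp [TensorProduct.smul_tmul']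
    have h2 : ∀ x : A ⊗[k] F, ((ρ.derivationF (c ⊗ₜ D)).toLinearMap.restrictScalars k).rTensor A
        (Algebra.TensorProduct.comm k A F x) =
        c • Algebra.TensorProduct.comm k A F ((ρ.derivation D).toLinearMap.lTensor A x) := by
      intro x
      induction x using TensorProduct.induction_on with
      | zero => simp
      | add x y hx hy => simp only [map_add, hx, hy, smul_add]
      | tmul a f => simp [TensorProduct.smul_tmul', derivationF_tmul_apply]
    rw [orbit_apply, h1, h2, rTensor_rightDerivation_coact]

/-- The orbit map is equivariant for left translations. -/
lemma leftDerivationExt_orbit (c : F) (D : Lie k A) (f : F) :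
    leftDerivationExt F (c ⊗ₜ D) (ρ.orbit f) = c • ρ.orbit (ρ.derivation D f) := by
  have h1 : ∀ x : A ⊗[k] F, leftDerivationExt F (c ⊗ₜ D)
      (Algebra.TensorProduct.comm k A F x) =
      c • Algebra.TensorProduct.comm k A F ((leftDerivation D).toLinearMap.rTensor F x) := by
    intro x
    induction x using TensorProduct.induction_on with
    | zero => simp
    | add x y hx hy => simp only [map_add, hx, hy, smul_add]
    | tmul a f => simp [TensorProduct.smul_tmul']
  rw [orbit_apply, h1, rTensor_leftDerivation_coact, orbit_apply]

end Action

end Coaction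

/-! ### Base change of the Lie algebra -/

section LieBaseChange

variable {k A : Type u} [Field k] [CommRing A] [HopfAlgebra k A]

/-- Functions dual to a basis of the Lie algebra. -/
lemma exists_dual_functions_basis {n : ℕ} (b : Module.Basis (Fin n) k (Lie k A)) :
    ∃ y : Fin n → A, (∀ i, Coalgebra.counit (R := k) (y i) = 0) ∧
      ∀ i j, (b i).1 (y j) = if i = j then 1 else 0 := by
  have hli : LinearIndependent k fun i => (b i).1 :=
    b.linearIndependent.map' (lieAlgebra k A k).subtype (Submodule.ker_subtype _)
  exact exists_dual_functions (Bialgebra.counitAlgHom k A) (fun i => (b i).1)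
    (fun i => lie_mem_pointDerivations _) hli

lemma pointDerivations_le_span {n : ℕ} (b : Module.Basis (Fin n) k (Lie k A)) :
    pointDerivations (Bialgebra.counitAlgHom k A) ≤
      Submodule.span k (Set.range fun i => (b i).1) := by
  intro D hD
  have h1 := b.mem_span (⟨D, hD⟩ : Lie k A)
  have h2 := Submodule.mem_map_of_mem (f := (lieAlgebra k A k).subtype) h1
  rw [Submodule.map_span, ← Set.range_comp] at h2
  exact h2

lemma lieBaseChange_tmul_apply (L : Type u) [CommRing L] [Algebra k L] (c : L) (D : Lie k A)
    (a : A) : (lieBaseChange k A L (c ⊗ₜ D)).1 a = c * algebraMap k L (D.1 a) := rfl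

/-- The formation of the Lie algebra commutes with base change. -/
lemma lieBaseChange_bijective [Module.Finite k (Lie k A)] (L : Type u) [CommRing L] [Algebra k L] :
    Function.Bijective (lieBaseChange k A L) := by
  classical
  let b := Module.finBasis k (Lie k A)
  obtain ⟨y, hy, hby⟩ := exists_dual_functions_basis b
  let bL : Module.Basis _ L (L ⊗[k] Lie k A) := Algebra.TensorProduct.basis L b
  constructor
  · rw [injective_iff_map_eq_zero]
    intro x hx
    refine bL.ext_elem fun i => ?_
    have h1 : ∀ x, (lieBaseChange k A L x).1 (y i) = bL.repr x i := by
      intro x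
      induction x using TensorProduct.induction_on with
      | zero => simp
      | add x x' hx hx' => simp [hx, hx']
      | tmul c D =>
        have h2 : D.1 (y i) = b.repr D i := by
          conv_lhs => rw [← b.sum_repr D]
          rw [AddSubmonoidClass.coe_finsetSum, LinearMap.sum_apply]
          simp [hby]
        simp [bL, lieBaseChange_tmul_apply, h2, Algebra.algebraMap_eq_smul_one]
    rw [← h1, hx]
    simp
  · intro D
    refine ⟨∑ j, D.1 (y j) ⊗ₜ b j, ?_⟩
    set D' := D - lieBaseChange k A L (∑ j, D.1 (y j) ⊗ₜ b j) with hD'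
    have hy' : ∀ i, D'.1 (y i) = 0 := by
      intro i
      simp only [hD', Submodule.coe_sub, LinearMap.sub_apply, map_sum,
        AddSubmonoidClass.coe_finsetSum, LinearMap.sum_apply, lieBaseChange_tmul_apply, hby]
      simp [Finset.sum_ite_eq']
    have h1 : D'.1 1 = 0 := by simpa using D'.2 1 1
    suffices D' = 0 from (sub_eq_zero.1 this).symm
    ext z
    have h2 := sub_sum_mem_ker_sq (Bialgebra.counitAlgHom k A) (fun i => (b i).1)
      (fun i => lie_mem_pointDerivations _) (pointDerivations_le_span b) y hy hby z
    have h3 : ∀ s ∈ RingHom.ker (Bialgebra.counitAlgHom k A) ^ 2, D'.1 s = 0 := by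
      intro s hs
      rw [pow_two] at hs
      refine Submodule.mul_induction_on hs (fun a ha c hc => ?_) (fun a c ha hc => ?_)
      · have ha' : Coalgebra.counit (R := k) a = 0 := ha
        have hc' : Coalgebra.counit (R := k) c = 0 := hc
        rw [D'.2, ha', hc']
        simp
      · rw [map_add, ha, hc, add_zero]
    have h4 := h3 _ h2
    rw [map_sub, map_sub, map_sum, Algebra.algebraMap_eq_smul_one, map_smul, h1] at h4
    simpa [hy'] using h4

end LieBaseChange

section

variable {p : ℕ} [Fact p.Prime] {k A : Type u} [Field k] [CommRing A] [HopfAlgebra k A]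

lemma IsHeightOne.finite_lie (hA : IsHeightOne p k A) : Module.Finite k (Lie k A) := by
  have := hA.finite
  infer_instance

lemma IsHeightOne.isNilpotent_ker_counit (hA : IsHeightOne p k A) :
    IsNilpotent (RingHom.ker (Bialgebra.counitAlgHom k A)) := by
  have := hA.finite
  have : IsNoetherianRing A := IsNoetherianRing.of_finite k _
  rw [Ideal.FG.isNilpotent_iff_le_nilradical (IsNoetherian.noetherian _)]
  exact fun x hx => ⟨p, hA.pow_eq_zero hx⟩

lemma nontrivial_of_hopfAlgebra (k A : Type u) [Field k] [CommRing A] [HopfAlgebra k A] :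
    Nontrivial A :=
  (Bialgebra.counitAlgHom k A).toRingHom.domain_nontrivial

/-- A function on a height-one group scheme that is killed by all invariant derivations is
constant. -/
lemma IsHeightOne.eq_algebraMap_of_leftDerivation_eq_zero [CharP k p] (hA : IsHeightOne p k A)
    (a : A) (ha : ∀ D : Lie k A, leftDerivation D a = 0) :
    a = algebraMap k A (Coalgebra.counit (R := k) a) := by
  classical
  have := hA.finite_lie
  have := nontrivial_of_hopfAlgebra k A
  let b := Module.finBasis k (Lie k A)
  obtain ⟨y, hy, hby⟩ := exists_dual_functions_basis b
  have hgen := adjoin_eq_top_of_dual (Bialgebra.counitAlgHom k A) (fun i => (b i).1)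
      (fun i => lie_mem_pointDerivations _) (pointDerivations_le_span b) y hy hby
      hA.isNilpotent_ker_counit
  obtain ⟨N, hN⟩ := exists_dual_derivations (Bialgebra.counitAlgHom k A)
    (fun r hr => ⟨p, hA.pow_eq_zero hr⟩) y (fun i => leftDerivation (b i)) (fun i j => by
      rw [← hby]
      exact counit_leftDerivation (b i) (y j))
  have h1 := mem_adjoin_image_of_derivation_eq_zero p y (fun i => hA.pow_eq_zero (hy i)) _ hN
    hgen ∅ a (fun i _ => by
      rw [← Derivation.coeFnAddMonoidHom_apply, map_sum, Finset.sum_apply]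
      exact Finset.sum_eq_zero fun l _ => by simp [ha])
  rw [Set.image_empty, Algebra.adjoin_empty] at h1
  obtain ⟨c, rfl⟩ := Algebra.mem_bot.1 h1
  simp

end

/-! ### The comorphism of the orbit map -/

section Orbit

variable {k A F : Type u} [Field k] [CommRing A] [HopfAlgebra k A] [Field F] [Algebra k F]
  (ρ : Action (k := k) (A := A) F)

namespace Action

/-- The elements killed by the Lie algebra are invariant under the group scheme. -/
lemma coact_of_mem_fixedField {p : ℕ} [Fact p.Prime] [CharP k p] (hA : IsHeightOne p k A) {e : F}
    (he : e ∈ ρ.fixedField) : ρ.coact e = 1 ⊗ₜ e := by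
  let v := Module.Basis.ofVectorSpace k F
  let w : Module.Basis _ A (A ⊗[k] F) := Algebra.TensorProduct.basis A v
  have hw : ∀ x i, w.repr x i = TensorProduct.rid k A ((v.coord i).lTensor A x) := by
    intro x i
    induction x using TensorProduct.induction_on with
    | zero => simp
    | add x y hx hy => simp [hx, hy]
    | tmul a f => simp [w, Algebra.smul_def, mul_comm]
  have h1 : ∀ (D : Lie k A) (l : F →ₗ[k] k) (x : A ⊗[k] F),
      leftDerivation D (TensorProduct.rid k A (l.lTensor A x)) =
        TensorProduct.rid k A (l.lTensor A ((leftDerivation D).toLinearMap.rTensor F x)) := by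
    intro D l x
    induction x using TensorProduct.induction_on with
    | zero => simp
    | add x y hx hy => simp only [map_add, hx, hy]
    | tmul a f => simp
  have h2 : ∀ (l : F →ₗ[k] k) (x : A ⊗[k] F),
      Coalgebra.counit (R := k) (TensorProduct.rid k A (l.lTensor A x)) =
        l (Algebra.TensorProduct.lid k F (Algebra.TensorProduct.map (Bialgebra.counitAlgHom k A)
          (AlgHom.id k F) x)) := by
    intro l x
    induction x using TensorProduct.induction_on with
    | zero => simp
    | add x y hx hy => simp only [map_add, hx, hy]
    | tmul a f => simp [mul_comm]
  -- The coordinates of `coact e` in a basis of `F` are functions on `H` that are killed by all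
  -- invariant derivations, hence constants.
  refine w.ext_elem fun i => ?_
  have h3 := hA.eq_algebraMap_of_leftDerivation_eq_zero
    (TensorProduct.rid k A ((v.coord i).lTensor A (ρ.coact e))) (fun D => by
      rw [h1, rTensor_leftDerivation_coact, he D]
      simp)
  rw [hw, hw, h3, h2, ρ.counit_coact]
  simp [Algebra.algebraMap_eq_smul_one]

lemma orbit_of_mem_fixedField {p : ℕ} [Fact p.Prime] [CharP k p] (hA : IsHeightOne p k A) {e : F}
    (he : e ∈ ρ.fixedField) : ρ.orbit e = e ⊗ₜ 1 := by
  rw [orbit_apply, ρ.coact_of_mem_fixedField hA he, Algebra.TensorProduct.comm_tmul]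

lemma mem_fixedField_iff_coact {p : ℕ} [Fact p.Prime] [CharP k p] (hA : IsHeightOne p k A)
    {e : F} :
    e ∈ ρ.fixedField ↔ ρ.coact e = 1 ⊗ₜ e := by
  refine ⟨ρ.coact_of_mem_fixedField hA, fun h D => ?_⟩
  rw [derivation_apply, h]
  simp [lie_map_one]

/-- Elements of `F` that are independent over the fixed field have independent images under the
orbit map. As in Artin's lemma, applying a derivation from the Lie algebra to the coefficients of
a relation of minimal length yields a shorter one, so the coefficients belong to the fixed
field. -/
lemma linearIndependent_orbit {ι : Type*} (v : ι → F) (hv : LinearIndependent ρ.fixedField v) :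
    LinearIndependent F fun i => ρ.orbit (v i) := by
  classical
  rw [linearIndependent_iff']
  intro s
  induction s using Finset.induction_on with
  | empty => simp
  | insert a s has ih =>
    have hδ : ∀ (D : Lie k A) (c : ι → F), ∑ i ∈ insert a s, c i • ρ.orbit (v i) = 0 →
        ∑ i ∈ insert a s, ρ.derivation D (c i) • ρ.orbit (v i) = 0 := by
      intro D c hc
      let δ : F ⊗[k] A →ₗ[k] F ⊗[k] A := (ρ.derivation D).toLinearMap.rTensor A
      have h1 : ∀ (c : F) (x : F ⊗[k] A), δ (c • x) = ρ.derivation D c • x + c • δ x := by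
        intro c x
        induction x using TensorProduct.induction_on with
        | zero => simp
        | add x y hx hy => simp only [smul_add, map_add, hx, hy]; abel
        | tmul f a =>
          simp only [δ, TensorProduct.smul_tmul', smul_eq_mul, LinearMap.rTensor_tmul,
            Derivation.coeFn_coe, Derivation.leibniz, TensorProduct.add_tmul, mul_comm, add_comm]
      have h2 : ∀ f, δ (ρ.orbit f) = rightDerivationExt F (1 ⊗ₜ D) (ρ.orbit f) := by
        intro f
        have h4 : (ρ.derivation D).toLinearMap =
            (ρ.derivationF (1 ⊗ₜ D)).toLinearMap.restrictScalars k := by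
          ext f
          exact ((derivationF_tmul_apply ρ 1 D f).trans (one_mul _)).symm
        rw [rightDerivationExt_orbit, ← h4]
      have h3 := congrArg δ hc
      rw [map_sum, map_zero] at h3
      simp only [h1, h2, Finset.sum_add_distrib] at h3
      rw [← h3, left_eq_add]
      have h4 := congrArg (rightDerivationExt F ((1 : F) ⊗ₜ D)) hc
      simpa using h4
    -- A relation that involves `a` can be normalized at `a`. Its derivatives do not involve `a`, so
    -- they are trivial, the coefficients belong to `E`, and the augmentation gives a relation
    -- over `E`.
    have key : ∀ c : ι → F, ∑ i ∈ insert a s, c i • ρ.orbit (v i) = 0 → c a = 0 := by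
      intro c hc
      by_contra hca
      set c' : ι → F := fun i => (c a)⁻¹ * c i with hc'
      have hsum : ∑ i ∈ insert a s, c' i • ρ.orbit (v i) = 0 := by
        simp only [hc', mul_smul, ← Finset.smul_sum, hc, smul_zero]
      have hca1 : c' a = 1 := inv_mul_cancel₀ hca
      have hfix : ∀ i ∈ insert a s, c' i ∈ ρ.fixedField := by
        intro i hi D
        rcases Finset.mem_insert.1 hi with rfl | hi
        · rw [hca1]; simp
        · have h5 := hδ D c' hsum
          rw [Finset.sum_insert has, hca1, Derivation.map_one_eq_zero, zero_smul, zero_add] at h5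
          exact ih _ h5 i hi
      have h6 := congrArg (augmentation k A F) hsum
      simp only [map_sum, map_smul, augmentation_orbit, map_zero] at h6
      have h7 := linearIndependent_iff'.1 hv (insert a s)
        (fun i => if h : c' i ∈ ρ.fixedField then ⟨c' i, h⟩ else 0) (by
          rw [← h6]
          refine Finset.sum_congr rfl fun i hi => ?_
          rw [dif_pos (hfix i hi)]
          rfl) a (Finset.mem_insert_self a s)
      rw [dif_pos (hfix a (Finset.mem_insert_self a s))] at h7
      exact one_ne_zero (hca1.symm.trans (congrArg Subtype.val h7))
    intro c hc i hi
    rcases Finset.mem_insert.1 hi with rfl | hi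
    · exact key c hc
    · refine ih c ?_ i hi
      have h8 := key c hc
      rwa [Finset.sum_insert has, h8, zero_smul, zero_add] at hc

/-- An `E`-basis of `F` gives an `F`-independent family in the finite-dimensional space `F ⊗ A`. -/
lemma finite_fixedField {p : ℕ} [Fact p.Prime] (hA : IsHeightOne p k A) :
    Module.Finite ρ.fixedField F := by
  have := hA.finite
  let v := Module.Basis.ofVectorSpace ρ.fixedField F
  have h1 := ρ.linearIndependent_orbit v v.linearIndependent
  have := h1.finite
  exact Module.Finite.of_basis v

variable {p : ℕ} [Fact p.Prime] [CharP k p] (hA : IsHeightOne p k A)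

/-- The comorphism `F ⊗[E] F → F ⊗[k] A` of the orbit map. -/
def orbitComorphism : F ⊗[ρ.fixedField] F →ₐ[F] F ⊗[k] A :=
  Algebra.TensorProduct.lift (Algebra.ofId F (F ⊗[k] A))
    { ρ.orbit with commutes' := fun e => ρ.orbit_of_mem_fixedField hA e.2 }
    fun _ _ => Commute.all _ _

lemma orbitComorphism_tmul (c f : F) : ρ.orbitComorphism hA (c ⊗ₜ f) = c • ρ.orbit f := by
  change algebraMap F (F ⊗[k] A) c * ρ.orbit f = _
  rw [Algebra.smul_def]

lemma orbitComorphism_injective : Function.Injective (ρ.orbitComorphism hA) := by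
  let v := Module.Basis.ofVectorSpace ρ.fixedField F
  let w : Module.Basis _ F (F ⊗[ρ.fixedField] F) := Algebra.TensorProduct.basis F v
  rw [injective_iff_map_eq_zero]
  intro x hx
  have h1 := ρ.linearIndependent_orbit v v.linearIndependent
  rw [← w.linearCombination_repr x, ← AlgHom.toLinearMap_apply, Finsupp.apply_linearCombination]
    at hx
  have h2 : (ρ.orbitComorphism hA).toLinearMap ∘ w = fun i => ρ.orbit (v i) := by
    funext i
    simp [w, orbitComorphism_tmul]
  rw [h2] at hx
  have h3 := linearIndependent_iff.1 h1 _ hx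
  exact w.repr.map_eq_zero_iff.1 h3

end Action

end Orbit

/-! ### Coordinates adapted to the orbit map -/

/-- A finite-dimensional space of `F`-valued derivations has a basis that is dual to suitable
elements. -/
lemma exists_basis_derivation_dual {E F : Type*} [Field E] [Field F] [Algebra E F]
    (V : Submodule F (Derivation E F F)) [Module.Finite F V] :
    ∃ (d : Fin (Module.finrank F V) → Derivation E F F) (f : Fin (Module.finrank F V) → F),
      LinearIndependent F d ∧ Submodule.span F (Set.range d) = V ∧
      ∀ i j, d i (f j) = if i = j then 1 else 0 := by
  classical
  let ev : F → Module.Dual F V := fun f =>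
    { toFun := fun v => v.1 f
      map_add' := fun _ _ => rfl
      map_smul' := fun _ _ => rfl }
  have hspan : ⊤ ≤ Submodule.span F (Set.range ev) := by
    by_contra hlt
    obtain ⟨φ, hφ0, hφ⟩ := Submodule.exists_le_ker_of_lt_top _
      (lt_of_le_not_ge le_top hlt)
    obtain ⟨v, rfl⟩ := (Module.evalEquiv F V).surjective φ
    refine hφ0 ?_
    have : v = 0 := by
      ext f
      exact hφ (Submodule.subset_span (Set.mem_range_self f))
    rw [this, map_zero]
  let c := Module.Basis.ofSpan hspan
  have hc : ∀ i, c i ∈ Set.range ev := fun i =>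
    Module.Basis.ofSpan_subset hspan (Set.mem_range_self i)
  have : Fintype _ := FiniteDimensional.fintypeBasisIndex c
  let e := Fintype.equivFinOfCardEq
    ((Module.finrank_eq_card_basis c).symm.trans (Subspace.dual_finrank_eq (K := F) (V := V)))
  choose f hf using fun j => hc (e.symm j)
  let d := ((c.reindex e).dualBasis).map (Module.evalEquiv F V).symm
  refine ⟨fun i => (d i).1, f, d.linearIndependent.map' V.subtype (Submodule.ker_subtype _), ?_,
    fun i j => ?_⟩
  · have h1 := congrArg (Submodule.map V.subtype) d.span_eq
    rw [Submodule.map_span, ← Set.range_comp, Submodule.map_top, Submodule.range_subtype] at h1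
    exact h1
  have h1 : ∀ φ : Module.Dual F (Module.Dual F V), ∀ x, ((Module.evalEquiv F V).symm φ).1 x =
      φ (ev x) := by
    intro φ x
    obtain ⟨v, rfl⟩ := (Module.evalEquiv F V).surjective φ
    rw [LinearEquiv.symm_apply_apply]
    rfl
  change (((c.reindex e).dualBasis.map (Module.evalEquiv F V).symm) i).1 (f j) = _
  rw [Module.Basis.map_apply, h1, hf]
  have h2 : c (e.symm j) = c.reindex e j := by simp
  rw [h2, Module.Basis.dualBasis_apply_self]
  simp [eq_comm]

/-- A basis of the range of a linear map, lifted to the source, together with a basis of the kernel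
is a basis of the source. -/
lemma exists_adapted_family {K M V ι : Type*} [Field K] [AddCommGroup M] [Module K M]
    [AddCommGroup V] [Module K V] [Module.Finite K M] [Fintype ι] (g : M →ₗ[K] V)
    (v : ι → V) (hv : LinearIndependent K v)
    (hspan : LinearMap.range g = Submodule.span K (Set.range v)) :
    ∃ (m : ℕ) (D : ι ⊕ Fin m → M), LinearIndependent K D ∧ ⊤ ≤ Submodule.span K (Set.range D) ∧
      (∀ i, g (D (Sum.inl i)) = v i) ∧ ∀ j, g (D (Sum.inr j)) = 0 := by
  classical
  have hlift : ∀ i, ∃ ξ, g ξ = v i := fun i => by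
    have : v i ∈ LinearMap.range g := by
      rw [hspan]
      exact Submodule.subset_span (Set.mem_range_self i)
    exact this
  choose D₁ hD₁ using hlift
  let b := Module.finBasis K (LinearMap.ker g)
  have hb : ∀ j, g (b j).1 = 0 := fun j => (b j).2
  refine ⟨_, Sum.elim D₁ fun j => (b j).1, ?_, ?_, hD₁, hb⟩
  · rw [Fintype.linearIndependent_iff]
    intro c hc
    simp only [Fintype.sum_sum_type, Sum.elim_inl, Sum.elim_inr] at hc
    have h1 : ∀ i, c (Sum.inl i) = 0 := by
      have h2 := congrArg g hc
      simp only [map_add, map_sum, map_smul, hD₁, hb, smul_zero, Finset.sum_const_zero, add_zero,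
        map_zero] at h2
      exact Fintype.linearIndependent_iff.1 hv _ h2
    simp only [h1, zero_smul, Finset.sum_const_zero, zero_add] at hc
    have h3 := Fintype.linearIndependent_iff.1 b.linearIndependent (fun j => c (Sum.inr j))
      (Subtype.ext (by simpa using hc))
    rintro (i | i)
    · exact h1 i
    · exact h3 i
  · intro ξ _
    have h1 : g ξ ∈ Submodule.span K (Set.range v) := by
      rw [← hspan]
      exact LinearMap.mem_range_self _ _
    obtain ⟨c, hc⟩ := (Submodule.mem_span_range_iff_exists_fun K).1 h1
    have h2 : g (ξ - ∑ i, c i • D₁ i) = 0 := by simp [hD₁, hc]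
    have h3 := congrArg Subtype.val (b.sum_repr ⟨_, h2⟩)
    have h4 : ξ = ∑ i, c i • D₁ i + ∑ i, b.repr ⟨_, h2⟩ i • (b i).1 := by
      rw [← sub_eq_iff_eq_add']
      rw [AddSubmonoidClass.coe_finsetSum] at h3
      exact h3.symm
    rw [h4]
    exact Submodule.add_mem _
      (Submodule.sum_mem _ fun i _ =>
        Submodule.smul_mem _ _ (Submodule.subset_span ⟨Sum.inl i, rfl⟩))
      (Submodule.sum_mem _ fun i _ =>
        Submodule.smul_mem _ _ (Submodule.subset_span ⟨Sum.inr i, rfl⟩))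

section Orbit

variable {p : ℕ} [Fact p.Prime] {k A F : Type u} [Field k] [CommRing A] [HopfAlgebra k A]
  [Field F] [Algebra k F]

variable (k A F) in
/-- The point derivation of `F ⊗ A` at the unit element given by an element of `F ⊗ Lie(H)`. -/
def tangentForm : F ⊗[k] Lie k A →ₗ[F] (F ⊗[k] A →ₗ[F] F) where
  toFun ξ := (augmentation k A F).toLinearMap ∘ₗ (rightDerivationExt F ξ).toLinearMap
  map_add' ξ η := by
    ext
    simp
  map_smul' c ξ := by
    ext
    simp

lemma tangentForm_apply (ξ : F ⊗[k] Lie k A) (x : F ⊗[k] A) :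
    tangentForm k A F ξ x = augmentation k A F (rightDerivationExt F ξ x) := rfl

lemma tangentForm_mem (ξ : F ⊗[k] Lie k A) :
    tangentForm k A F ξ ∈ pointDerivations (augmentation k A F) := by
  intro x y
  simp [tangentForm_apply]

lemma tangentForm_injective [Module.Finite k (Lie k A)] :
    Function.Injective (tangentForm k A F) := by
  intro ξ η h
  refine (lieBaseChange_bijective F).1 (Subtype.ext (LinearMap.ext fun a => ?_))
  rw [← augmentation_rightDerivationExt, ← augmentation_rightDerivationExt]
  exact LinearMap.congr_fun h _

lemma pointDerivations_le_range_tangentForm [Module.Finite k (Lie k A)] :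
    pointDerivations (augmentation k A F) ≤ LinearMap.range (tangentForm k A F) := by
  intro D hD
  let D' : LieExt k A F := ⟨D.restrictScalars k ∘ₗ
    (Algebra.TensorProduct.includeRight : A →ₐ[k] F ⊗[k] A).toLinearMap, by
      intro a b
      have := hD (1 ⊗ₜ a) (1 ⊗ₜ b)
      simpa using this⟩
  obtain ⟨ξ, hξ⟩ := (lieBaseChange_bijective (k := k) (A := A) F).2 D'
  refine ⟨ξ, ?_⟩
  ext a
  have h1 := augmentation_rightDerivationExt F ξ a
  rw [hξ] at h1
  exact h1

namespace Action

variable (ρ : Action (k := k) (A := A) F)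

lemma range_derivationF : LinearMap.range ρ.derivationF = ρ.lieF := by
  apply le_antisymm
  · rintro _ ⟨ξ, rfl⟩
    induction ξ using TensorProduct.induction_on with
    | zero => simp
    | add x y hx hy => rw [map_add]; exact Submodule.add_mem _ hx hy
    | tmul c D => exact Submodule.smul_mem _ _ (Submodule.subset_span (Set.mem_range_self D))
  · refine Submodule.span_le.2 ?_
    rintro _ ⟨D, rfl⟩
    exact ⟨1 ⊗ₜ D, by simp [derivationF]⟩

/-- The differential of the orbit map at the unit element is the map `F ⊗ 𝔥 → Der_E(F)`. -/
lemma tangentForm_orbit (ξ : F ⊗[k] Lie k A) (f : F) :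
    tangentForm k A F ξ (ρ.orbit f) = ρ.derivationF ξ f := by
  have key : ∀ (d : F →ₗ[k] F) (x : F ⊗[k] A), augmentation k A F (d.rTensor A x) =
      d (augmentation k A F x) := by
    intro d x
    induction x using TensorProduct.induction_on with
    | zero => simp
    | add x y hx hy => simp only [map_add, hx, hy]
    | tmul f a => simp [mul_comm _ (algebraMap k F _), ← Algebra.smul_def]
  rw [tangentForm_apply, rightDerivationExt_orbit, key, augmentation_orbit]
  rfl

/-- There is a system of coordinates of `H_F` at the unit element, together with dual derivations,
such that the first block of coordinates generates the image of the comorphism of the orbit map.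
The derivations in the second block come from the elements of `F ⊗ Lie(H)` that map to zero
in `Der_E(F)`, hence kill this image. -/
theorem exists_adapted_coordinates [CharP k p] (hA : IsHeightOne p k A) :
    ∃ (m : ℕ) (f : Fin (Module.finrank F ρ.lieF) → F)
      (v : Fin (Module.finrank F ρ.lieF) → Derivation ρ.fixedField F F)
      (y : Fin (Module.finrank F ρ.lieF) ⊕ Fin m → F ⊗[k] A)
      (d : Fin (Module.finrank F ρ.lieF) ⊕ Fin m → Derivation F (F ⊗[k] A) (F ⊗[k] A)),
      (∀ i, v i ∈ ρ.lieF) ∧ (∀ i j, v i (f j) = if i = j then 1 else 0) ∧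
      (∀ i, y (Sum.inl i) = ρ.orbit (f i) - f i ⊗ₜ 1) ∧
      (∀ i, y i ^ p = 0) ∧ (∀ i j, d i (y j) = if i = j then 1 else 0) ∧
      Algebra.adjoin F (Set.range y) = ⊤ ∧
      (ρ.orbitComorphism hA).range = Algebra.adjoin F (Set.range fun i => y (Sum.inl i)) := by
  classical
  have := hA.finite_lie
  have := nontrivial_of_hopfAlgebra k A
  have hFp : CharP F p := charP_of_injective_algebraMap (algebraMap k F).injective p
  have : Module.Finite F ρ.lieF := by
    rw [← range_derivationF]
    infer_instance
  -- `vᵢ` is a basis of `𝔥 · F` with dual elements `fᵢ`. It is lifted to `F ⊗ 𝔥`, and completed to a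
  -- basis `Dᵢ` by a basis of the kernel of `F ⊗ 𝔥 → Der_E(F)`.
  obtain ⟨v, f, hv1, hv, hvf⟩ := exists_basis_derivation_dual ρ.lieF
  have hv2 : LinearMap.range ρ.derivationF = Submodule.span F (Set.range v) := by
    rw [hv, range_derivationF]
  obtain ⟨m, D, hli, hspan, hD1, hD2⟩ := exists_adapted_family ρ.derivationF _ hv1 hv2
  have hDf : ∀ i j, ρ.derivationF (D i) (f j) = if i = Sum.inl j then 1 else 0 := by
    rintro (i | i) j
    · rw [hD1, hvf]
      simp
    · rw [hD2]; simp
  have hT : pointDerivations (augmentation k A F) ≤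
      Submodule.span F (Set.range fun i => tangentForm k A F (D i)) := by
    have h1 := pointDerivations_le_range_tangentForm (k := k) (A := A) (F := F)
    rw [LinearMap.range_eq_map, ← top_le_iff.1 hspan, Submodule.map_span, ← Set.range_comp] at h1
    exact h1
  have hTli : LinearIndependent F fun i => tangentForm k A F (D i) :=
    hli.map' _ (LinearMap.ker_eq_bot.2 tangentForm_injective)
  obtain ⟨y', hy', hDy'⟩ := exists_dual_functions (augmentation k A F) _
    (fun i => tangentForm_mem (D i)) hTli
  -- The coordinates of the first block come from `F ⊗[E] F`, the others are arbitrary.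
  let y : Fin (Module.finrank F ρ.lieF) ⊕ Fin m → F ⊗[k] A :=
    Sum.elim (fun i => ρ.orbit (f i) - f i ⊗ₜ 1) fun j => y' (Sum.inr j)
  have hy : ∀ i, augmentation k A F (y i) = 0 := by
    rintro (i | i)
    · simp [y, augmentation_orbit]
    · exact hy' _
  have hconst : ∀ (δ : Derivation F (F ⊗[k] A) (F ⊗[k] A)) (c : F), δ (c ⊗ₜ 1) = 0 :=
    fun δ c => δ.map_algebraMap c
  have hDy : ∀ i j, tangentForm k A F (D i) (y j) = if i = j then 1 else 0 := by
    rintro i (j | j)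
    · change tangentForm k A F (D i) (ρ.orbit (f j) - f j ⊗ₜ 1) = _
      rw [map_sub, tangentForm_orbit, hDf, tangentForm_apply _ (f j ⊗ₜ 1), hconst]
      simp
    · exact hDy' _ _
  have hpow : ∀ i, y i ^ p = 0 := fun i => by
    rw [hA.pow_eq_augmentation, hy, zero_pow (Fact.out : p.Prime).ne_zero, map_zero]
  have hnil : ∀ x, augmentation k A F x = 0 → IsNilpotent x := fun x hx => ⟨p, by
    rw [hA.pow_eq_augmentation, hx, zero_pow (Fact.out : p.Prime).ne_zero, map_zero]⟩
  have hgen := adjoin_eq_top_of_dual (augmentation k A F) _ (fun i => tangentForm_mem (D i)) hT y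
    hy hDy (hA.isNilpotent_ker_augmentation F)
  -- For the second block, only combinations of the derivations `Dⱼ` of this block are used, so that
  -- they kill the image of the comorphism, and in particular the coordinates of the first block.
  obtain ⟨N₁, hN₁⟩ := exists_dual_derivations (augmentation k A F) hnil y
    (fun i => rightDerivationExt F (D i)) hDy
  obtain ⟨N₂, hN₂⟩ := exists_dual_derivations (augmentation k A F) hnil (fun j => y (Sum.inr j))
    (fun i => rightDerivationExt F (D (Sum.inr i))) (fun i j => by
      have := hDy (Sum.inr i) (Sum.inr j)
      rw [tangentForm_apply] at this
      simpa using this)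
  have hker : ∀ j f, rightDerivationExt F (D (Sum.inr j)) (ρ.orbit f) = 0 := by
    intro j f
    rw [rightDerivationExt_orbit, hD2]
    exact LinearMap.congr_fun (LinearMap.rTensor_zero A) _
  have hker' : ∀ j x, (∑ l, N₂ j l • rightDerivationExt F (D (Sum.inr l)))
      (ρ.orbitComorphism hA x) = 0 := by
    intro j x
    rw [← Derivation.coeFnAddMonoidHom_apply, map_sum, Finset.sum_apply]
    refine Finset.sum_eq_zero fun l _ => ?_
    rw [Derivation.coeFnAddMonoidHom_apply, Derivation.smul_apply]
    induction x using TensorProduct.induction_on with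
    | zero => simp
    | add x y hx hy => rw [map_add, map_add, smul_add, hx, hy, add_zero]
    | tmul c f => rw [orbitComorphism_tmul, Derivation.map_smul, hker, smul_zero, smul_zero]
  have hyrange : ∀ i, ρ.orbitComorphism hA (1 ⊗ₜ f i - f i ⊗ₜ 1) = y (Sum.inl i) := by
    intro i
    rw [map_sub, orbitComorphism_tmul, orbitComorphism_tmul, map_one, one_smul,
      Algebra.smul_def, mul_one]
    rfl
  let d : Fin (Module.finrank F ρ.lieF) ⊕ Fin m → Derivation F (F ⊗[k] A) (F ⊗[k] A) :=
    Sum.elim (fun i => ∑ l, N₁ (Sum.inl i) l • rightDerivationExt F (D l))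
      (fun j => ∑ l, N₂ j l • rightDerivationExt F (D (Sum.inr l)))
  have hd : ∀ i j, d i (y j) = if i = j then 1 else 0 := by
    rintro (i | i) j
    · exact hN₁ _ _
    · rcases j with j | j
      · rw [← hyrange, if_neg Sum.inr_ne_inl]
        exact hker' i _
      · simp only [Sum.inr.injEq]
        exact hN₂ i j
  refine ⟨m, f, v, y, d, fun i => by
    rw [← hv]
    exact Submodule.subset_span (Set.mem_range_self i), hvf, fun i => rfl, hpow, hd, hgen, ?_⟩
  apply le_antisymm
  · rintro _ ⟨x, rfl⟩
    have h1 := mem_adjoin_image_of_derivation_eq_zero p y hpow d hd hgen (Set.range Sum.inl)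
      (ρ.orbitComorphism hA x) (by
        rintro (i | i) hi
        · exact absurd ⟨i, rfl⟩ hi
        · exact hker' i x)
    rwa [← Set.range_comp] at h1
  · rw [Algebra.adjoin_le_iff]
    rintro _ ⟨i, rfl⟩
    exact ⟨_, hyrange i⟩

end Action
end Orbit

/-! ### Freeness over the image of the orbit map -/

section Orbit

variable {p : ℕ} [Fact p.Prime] {k A F : Type u} [Field k] [CommRing A] [HopfAlgebra k A]
  [Field F] [Algebra k F]

/-- A finite free ring extension becomes an fppf cover after every base change. -/
lemma exists_fppf_of_free {B C : Type u} [CommRing B] [CommRing C] [IsNoetherianRing B]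
    [Nontrivial C] [Algebra B C] [Module.Free B C] [Module.Finite B C] {R : Type u} [CommRing R]
    (β : B →+* R) :
    ∃ (S : Type u) (_ : CommRing S) (_ : Algebra R S), Module.FaithfullyFlat R S ∧
      Algebra.FinitePresentation R S ∧
        ∃ γ : C →+* S, γ.comp (algebraMap B C) = (algebraMap R S).comp β := by
  algebraize [β]
  have : Algebra.FinitePresentation B C := Algebra.FinitePresentation.of_finiteType.1 inferInstance
  refine ⟨R ⊗[B] C, inferInstance, inferInstance, inferInstance, inferInstance,
    (Algebra.TensorProduct.includeRight : C →ₐ[B] R ⊗[B] C).toRingHom, ?_⟩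
  ext b
  exact (AlgHom.commutes (Algebra.TensorProduct.includeRight : C →ₐ[B] R ⊗[B] C) b).trans
    (IsScalarTower.algebraMap_apply B R (R ⊗[B] C) b)

namespace Action

variable (ρ : Action (k := k) (A := A) F) [CharP k p] (hA : IsHeightOne p k A)

/-- The coordinate ring of `H_F` is finite and free over `F ⊗[E] F`, and the degree of `F` over `E`
is determined by the number of coordinates. -/
lemma free_orbitComorphism :
    Module.finrank ρ.fixedField F = p ^ Module.finrank F ρ.lieF ∧
    letI := (ρ.orbitComorphism hA).toRingHom.toAlgebra
    Module.Free (F ⊗[ρ.fixedField] F) (F ⊗[k] A) ∧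
      Module.Finite (F ⊗[ρ.fixedField] F) (F ⊗[k] A) := by
  let := (ρ.orbitComorphism hA).toRingHom.toAlgebra
  have : IsScalarTower F (F ⊗[ρ.fixedField] F) (F ⊗[k] A) :=
    IsScalarTower.of_algebraMap_eq fun c => ((ρ.orbitComorphism hA).commutes c).symm
  have := nontrivial_of_hopfAlgebra k A
  have hFp : CharP F p := charP_of_injective_algebraMap (algebraMap k F).injective p
  obtain ⟨m, f, v, y, d, -, -, -, hpow, hd, hgen, hrange⟩ := ρ.exists_adapted_coordinates hA
  have h1 := free_of_range_eq_adjoin (B := F ⊗[ρ.fixedField] F) p y hpow d hd hgen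
    (ρ.orbitComorphism_injective hA) (by
      rw [← hrange]
      rfl)
  rw [Module.finrank_baseChange, Fintype.card_fin] at h1
  exact h1

/-- The image of the Lie algebra generates all derivations of `F` over the fixed field: the
elements `1 ⊗ fᵢ` generate the `F`-algebra `F ⊗[E] F`, so a derivation that kills all `fᵢ`
vanishes. -/
theorem lieF_eq_top {p : ℕ} [Fact p.Prime] [CharP k p] (hA : IsHeightOne p k A) : ρ.lieF = ⊤ := by
  obtain ⟨m, f, v, y, d, hv, hvf, hyf, -, -, -, hrange⟩ := ρ.exists_adapted_coordinates hA
  rw [eq_top_iff]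
  intro D _
  -- After subtracting a combination of the `vᵢ`, the derivation kills all `fᵢ`.
  set D' : Derivation ρ.fixedField F F := D - ∑ i, D (f i) • v i with hD'
  have hD'f : ∀ i, D' (f i) = 0 := by
    intro i
    rw [hD', Derivation.sub_apply, ← Derivation.coeFnAddMonoidHom_apply (∑ i, D (f i) • v i),
      map_sum, Finset.sum_apply]
    simp [hvf]
  let t : Fin (Module.finrank F ρ.lieF) → F ⊗[ρ.fixedField] F := fun i => 1 ⊗ₜ f i - f i ⊗ₜ 1
  have ht : ∀ i, ρ.orbitComorphism hA (t i) = y (Sum.inl i) := by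
    intro i
    rw [hyf, map_sub, orbitComorphism_tmul, orbitComorphism_tmul, map_one, one_smul,
      Algebra.smul_def, mul_one]
    rfl
  have hgen : Algebra.adjoin F (Set.range t) = ⊤ := by
    rw [eq_top_iff]
    intro x _
    have h1 : ρ.orbitComorphism hA x ∈ (ρ.orbitComorphism hA).range := ⟨x, rfl⟩
    rw [hrange] at h1
    have h2 : (Set.range fun i => y (Sum.inl i)) = ρ.orbitComorphism hA '' Set.range t := by
      rw [← Set.range_comp]
      exact congrArg Set.range (funext fun i => (ht i).symm)
    rw [h2, ← AlgHom.map_adjoin] at h1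
    obtain ⟨x', hx', h3⟩ := h1
    rwa [← ρ.orbitComorphism_injective hA h3]
  have h4 : derivationBaseChange F D' = 0 := by
    refine Derivation.ext_of_adjoin_eq_top _ hgen ?_
    rintro _ ⟨i, rfl⟩
    simp [t, hD'f]
  have h5 : D' = 0 := by
    ext x
    have h6 := congrArg (fun δ => Algebra.TensorProduct.lmul' ρ.fixedField
      (δ ((1 : F) ⊗ₜ[ρ.fixedField] x))) h4
    simpa using h6
  rw [sub_eq_zero.1 (hD'.symm.trans h5)]
  exact Submodule.sum_mem _ fun i _ => Submodule.smul_mem _ _ (hv i)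

/-- A point of `Spec(F ⊗[E] F)` lifts to `H_F` over an fppf extension. -/
lemma exists_fppf_orbit {R : Type u} [CommRing R] (β : F ⊗[ρ.fixedField] F →+* R) :
    ∃ (S : Type u) (_ : CommRing S) (_ : Algebra R S), Module.FaithfullyFlat R S ∧
      Algebra.FinitePresentation R S ∧
        ∃ γ : F ⊗[k] A →+* S,
          ∀ x, γ (ρ.orbitComorphism hA x) = algebraMap R S (β x) := by
  let := (ρ.orbitComorphism hA).toRingHom.toAlgebra
  obtain ⟨-, hfree, hfin⟩ := ρ.free_orbitComorphism hA
  have := nontrivial_of_hopfAlgebra k A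
  have := ρ.finite_fixedField hA
  have : IsNoetherianRing (F ⊗[ρ.fixedField] F) := IsNoetherianRing.of_finite F _
  obtain ⟨S, i1, i2, h1, h2, γ, hγ⟩ := exists_fppf_of_free (C := F ⊗[k] A) β
  exact ⟨S, i1, i2, h1, h2, γ, fun x => RingHom.congr_fun hγ x⟩

/-- The action of a point on a point, computed from a homomorphism out of `F ⊗ A`. -/
lemma act_eq_of_comp {R : Type u} [CommRing R] [Algebra k R] (g : Points k A R) (z : F →ₐ[k] R)
    (γ : F ⊗[k] A →+* R) (h1 : ∀ f, γ (f ⊗ₜ 1) = z f) (h2 : ∀ a, γ (1 ⊗ₜ a) = g.ofConv a)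
    (f : F) : ρ.act g z f = γ (ρ.orbit f) := by
  have key : ∀ x : A ⊗[k] F, Algebra.TensorProduct.productMap g.ofConv z x =
      γ (Algebra.TensorProduct.comm k A F x) := by
    intro x
    induction x using TensorProduct.induction_on with
    | zero => simp
    | add x y hx hy => simp only [map_add, hx, hy]
    | tmul a f =>
      have h3 : f ⊗ₜ[k] a = f ⊗ₜ 1 * 1 ⊗ₜ a := by simp
      rw [Algebra.TensorProduct.productMap_apply_tmul, Algebra.TensorProduct.comm_tmul, h3,
        map_mul, h1, h2, mul_comm]
  exact key _

/-- A pair of points of `Spec F` over `E` is a point of `Spec(F ⊗[E] F)`, and lifts to `H_F` over an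
fppf extension. -/
theorem isTransitive (hA : IsHeightOne p k A) : ρ.IsTransitive := by
  intro R _ _ _ _
  refine ⟨fun g a e => ?_, fun a b => ?_⟩
  · change Algebra.TensorProduct.productMap g.ofConv (a.restrictScalars k) (ρ.coact e) = _
    rw [ρ.coact_of_mem_fixedField hA e.2]
    simpa using a.commutes e
  · obtain ⟨S, i1, i2, h1, h2, γ, hγ⟩ := ρ.exists_fppf_orbit hA
      (Algebra.TensorProduct.productMap a b).toRingHom
    let : Algebra k S := ((algebraMap R S).comp (algebraMap k R)).toAlgebra
    have hγ1 : ∀ c, γ (c ⊗ₜ 1) = algebraMap R S (a c) := by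
      intro c
      have := hγ (c ⊗ₜ 1)
      rw [orbitComorphism_tmul, map_one, Algebra.smul_def, mul_one] at this
      refine this.trans ?_
      simp
    let g : A →ₐ[k] S :=
      { γ.comp (Algebra.TensorProduct.includeRight : A →ₐ[k] F ⊗[k] A).toRingHom with
        commutes' := fun r => by
          have h3 := hγ1 (algebraMap k F r)
          rw [← AlgHom.restrictScalars_apply k a, AlgHom.commutes] at h3
          change γ (1 ⊗ₜ algebraMap k A r) = algebraMap R S (algebraMap k R r)
          rw [← h3, Algebra.algebraMap_eq_smul_one, Algebra.algebraMap_eq_smul_one,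
            TensorProduct.smul_tmul] }
    refine ⟨S, i1, i2, inferInstance, IsScalarTower.of_algebraMap_eq fun _ => rfl, h1, h2,
      WithConv.toConv g, ?_⟩
    ext f
    rw [ρ.act_eq_of_comp _ _ γ hγ1 (fun a => rfl)]
    have := hγ (1 ⊗ₜ f)
    rw [orbitComorphism_tmul, one_smul] at this
    rw [this]
    simp

lemma isOrbitComorphism : ρ.IsOrbitComorphism (ρ.orbitComorphism hA) :=
  fun c f => ρ.orbitComorphism_tmul hA c f

/-- The fibers of the orbit map are the cosets of the stabilizer, and the orbit map is an
epimorphism of fppf sheaves. -/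
theorem isInertiaQuotient : ρ.IsInertiaQuotient (ρ.orbitComorphism hA) := by
  intro R _ _ _ _
  have key : ∀ (g : Points k A R) (c f : F), (pointExt g).comp (ρ.orbitComorphism hA) (c ⊗ₜ f) =
      algebraMap F R c * ρ.act g (basePoint k (F := F) R) f := by
    intro g c f
    rw [AlgHom.comp_apply, orbitComorphism_tmul, map_smul, Algebra.smul_def]
    congr 1
    exact (ρ.act_eq_of_comp g _ (pointExt g).toRingHom (fun f => by simp [pointExt, basePoint])
      (fun a => by simp [pointExt]) f).symm
  refine ⟨fun g g' => ?_, fun z => ?_⟩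
  · have h1 : (pointExt g).comp (ρ.orbitComorphism hA) = (pointExt g').comp (ρ.orbitComorphism hA) ↔
        ρ.act g (basePoint k (F := F) R) = ρ.act g' (basePoint k (F := F) R) := by
      constructor
      · intro h
        ext f
        have := AlgHom.congr_fun h (1 ⊗ₜ f)
        simpa only [key, map_one, one_mul] using this
      · intro h
        ext f
        have h2 := key g 1 f
        have h3 := key g' 1 f
        rw [h] at h2
        exact h2.trans h3.symm
    have h2 : g⁻¹ * g' ∈ ρ.inertia R ↔
        ρ.act (g⁻¹ * g') (basePoint k (F := F) R) = basePoint k (F := F) R := Iff.rfl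
    rw [h1, h2, act_mul]
    constructor
    · intro h
      rw [← h, ← act_mul, inv_mul_cancel, act_one]
    · intro h
      rw [← h, ← act_mul, mul_inv_cancel, act_one, h]
  · obtain ⟨S, i1, i2, h1, h2, γ, hγ⟩ := ρ.exists_fppf_orbit hA z.toRingHom
    let : Algebra k S := ((algebraMap R S).comp (algebraMap k R)).toAlgebra
    let : Algebra F S := ((algebraMap R S).comp (algebraMap F R)).toAlgebra
    have hγ1 : ∀ c, γ (c ⊗ₜ 1) = algebraMap R S (algebraMap F R c) := by
      intro c
      have := hγ (c ⊗ₜ 1)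
      rw [orbitComorphism_tmul, map_one, Algebra.smul_def, mul_one] at this
      exact this.trans (congrArg _ (z.commutes c))
    let g : A →ₐ[k] S :=
      { γ.comp (Algebra.TensorProduct.includeRight : A →ₐ[k] F ⊗[k] A).toRingHom with
        commutes' := fun r => by
          have h3 := hγ1 (algebraMap k F r)
          rw [← IsScalarTower.algebraMap_apply k F R] at h3
          change γ (1 ⊗ₜ algebraMap k A r) = algebraMap R S (algebraMap k R r)
          rw [← h3, Algebra.algebraMap_eq_smul_one, Algebra.algebraMap_eq_smul_one,
            TensorProduct.smul_tmul] }
    have hkFS : IsScalarTower k F S := IsScalarTower.of_algebraMap_eq fun r =>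
      congrArg (algebraMap R S) (IsScalarTower.algebraMap_apply k F R r)
    have hFRS : IsScalarTower F R S := IsScalarTower.of_algebraMap_eq fun _ => rfl
    refine ⟨S, i1, i2, inferInstance, inferInstance, hkFS, hFRS, h1, h2, WithConv.toConv g, ?_⟩
    have h4 : ∀ x, pointExt (F := F) (WithConv.toConv g) x = γ x := by
      intro x
      induction x using TensorProduct.induction_on with
      | zero => simp
      | add x y hx hy => simp only [map_add, hx, hy]
      | tmul f a =>
        have h3 : f ⊗ₜ[k] a = f ⊗ₜ 1 * 1 ⊗ₜ a := by simp
        rw [h3, map_mul, map_mul, hγ1]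
        congr 1
        · simp only [pointExt, Algebra.TensorProduct.lift_tmul, map_one, mul_one,
            Algebra.ofId_apply]
          rfl
        · simp only [pointExt, Algebra.TensorProduct.lift_tmul, map_one, one_mul]
          rfl
    refine AlgHom.ext fun x => ?_
    rw [AlgHom.comp_apply, h4, hγ]
    rfl

end Action
end Orbit

/-! ### Powers of derivations -/

section Leibniz

variable {R C : Type*} [CommRing R] [CommRing C] [Algebra R C]

/-- The general Leibniz rule for the iterates of a derivation. -/
lemma derivation_iterate_mul (D : Derivation R C C) (n : ℕ) (a b : C) :
    D^[n] (a * b) = ∑ ij ∈ Finset.HasAntidiagonal.antidiagonal n,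
      n.choose ij.1 • (D^[ij.1] a * D^[ij.2] b) := by
  induction n with
  | zero => simp
  | succ n ih =>
    rw [Finset.sum_antidiagonal_choose_succ_nsmul (M := C) (fun i j => D^[i] a * D^[j] b) n]
    simp only [Function.iterate_succ_apply', ih, map_sum, map_nsmul, Derivation.leibniz, smul_add,
      smul_eq_mul, Finset.sum_add_distrib, add_right_inj]
    refine Finset.sum_congr rfl fun ⟨i, j⟩ hij => ?_
    rw [n.choose_symm_of_eq_add (Finset.HasAntidiagonal.mem_antidiagonal.1 hij).symm, mul_comm]

/-- In characteristic `p`, the `p`-th iterate of a derivation is a derivation. -/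
def derivationPow (p : ℕ) [Fact p.Prime] [CharP C p] (D : Derivation R C C) : Derivation R C C :=
  Derivation.mk' (D.toLinearMap ^ p) (by
    intro a b
    have h1 : ∀ x, (D.toLinearMap ^ p) x = D^[p] x := fun x => Module.End.pow_apply _ _ _
    have hp : p.Prime := Fact.out
    rw [h1, h1, h1, derivation_iterate_mul,
      Finset.Nat.sum_antidiagonal_eq_sum_range_succ
        (fun i j => p.choose i • (D^[i] a * D^[j] b)), Finset.sum_range_succ,
      Finset.sum_eq_single_of_mem 0 (Finset.mem_range.2 hp.pos)]
    · simp [mul_comm]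
    · intro i hi hi0
      obtain ⟨c, hc⟩ := hp.dvd_choose_self hi0 (Finset.mem_range.1 hi)
      rw [hc, mul_comm p c, mul_smul, nsmul_eq_mul p, CharP.cast_eq_zero, zero_mul, smul_zero])

lemma derivationPow_apply (p : ℕ) [Fact p.Prime] [CharP C p] (D : Derivation R C C) (x : C) :
    derivationPow p D x = D^[p] x :=
  Module.End.pow_apply _ _ _

end Leibniz

/-! ### Closure under brackets and `p`-th powers -/

section FixedField

variable {k A F : Type u} [Field k] [CommRing A] [HopfAlgebra k A] [Field F] [Algebra k F]
  (ρ : Action (k := k) (A := A) F)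

namespace Action

lemma mem_fixedField_iff_lieE (f : F) : f ∈ ρ.fixedField ↔ ∀ D ∈ ρ.lieE, D f = 0 := by
  constructor
  · intro hf D _
    exact D.map_algebraMap (⟨f, hf⟩ : ρ.fixedField)
  · intro h D
    exact h _ (Submodule.subset_span (Set.mem_range_self D))

lemma mem_fixedField_iff_lieF (f : F) : f ∈ ρ.fixedField ↔ ∀ D ∈ ρ.lieF, D f = 0 := by
  constructor
  · intro hf D _
    exact D.map_algebraMap (⟨f, hf⟩ : ρ.fixedField)
  · intro h D
    exact h _ (Submodule.subset_span (Set.mem_range_self D))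

/-- The inclusion of the coordinate ring of `H_E` in that of `H_F`. -/
def inclusionExt : ρ.fixedField ⊗[k] A →ₐ[k] F ⊗[k] A :=
  Algebra.TensorProduct.map ρ.fixedField.val (AlgHom.id k A)

lemma augmentation_inclusionExt (x : ρ.fixedField ⊗[k] A) :
    augmentation k A F (ρ.inclusionExt x) = augmentation k A ρ.fixedField x := by
  induction x using TensorProduct.induction_on with
  | zero => simp
  | add x y hx hy => simp only [map_add, hx, hy, ρ.fixedField.coe_add]
  | tmul e a =>
    simp only [inclusionExt, Algebra.TensorProduct.map_tmul, augmentation_tmul, AlgHom.id_apply]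
    rfl

/-- The inclusion of `E ⊗ 𝔥` in `F ⊗ 𝔥`. -/
def inclusionLie : ρ.fixedField ⊗[k] Lie k A →ₗ[k] F ⊗[k] Lie k A :=
  ρ.fixedField.val.toLinearMap.rTensor (Lie k A)

lemma leftDerivationExt_inclusionExt (ξ : ρ.fixedField ⊗[k] Lie k A) (x : ρ.fixedField ⊗[k] A) :
    leftDerivationExt F (ρ.inclusionLie ξ) (ρ.inclusionExt x) =
      ρ.inclusionExt (leftDerivationExt ρ.fixedField ξ x) := by
  induction ξ using TensorProduct.induction_on with
  | zero => simp
  | add ξ ξ' h h' => simp only [map_add, Derivation.add_apply, h, h']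
  | tmul c D =>
    induction x using TensorProduct.induction_on with
    | zero => simp
    | add x y hx hy => simp only [map_add, hx, hy]
    | tmul e a => simp [inclusionExt, inclusionLie]

/-- The map `E ⊗ 𝔥 → Der_E(F)`. -/
def derivationFixed : ρ.fixedField ⊗[k] Lie k A →ₗ[ρ.fixedField] Derivation ρ.fixedField F F :=
  ρ.derivationE.liftBaseChange ρ.fixedField

lemma derivationFixed_tmul_apply (c : ρ.fixedField) (D : Lie k A) (f : F) :
    ρ.derivationFixed (c ⊗ₜ D) f = c * ρ.derivation D f := rfl

lemma range_derivationFixed : LinearMap.range ρ.derivationFixed = ρ.lieE := by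
  apply le_antisymm
  · rintro _ ⟨ξ, rfl⟩
    induction ξ using TensorProduct.induction_on with
    | zero => simp
    | add x y hx hy => rw [map_add]; exact Submodule.add_mem _ hx hy
    | tmul c D => exact Submodule.smul_mem _ _ (Submodule.subset_span (Set.mem_range_self D))
  · refine Submodule.span_le.2 ?_
    rintro _ ⟨D, rfl⟩
    exact ⟨1 ⊗ₜ D, by simp [derivationFixed]⟩

lemma lieBaseChange_inclusionLie (ξ : ρ.fixedField ⊗[k] Lie k A) (a : A) :
    (lieBaseChange k A F (ρ.inclusionLie ξ)).1 a =
      ((lieBaseChange k A ρ.fixedField ξ).1 a : ρ.fixedField) := by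
  induction ξ using TensorProduct.induction_on with
  | zero => simp
  | add ξ ξ' h h' =>
    simp only [map_add, Submodule.coe_add, LinearMap.add_apply, h, h', ρ.fixedField.coe_add]
  | tmul c D => rfl

lemma derivationF_inclusionLie (ξ : ρ.fixedField ⊗[k] Lie k A) (f : F) :
    ρ.derivationF (ρ.inclusionLie ξ) f = ρ.derivationFixed ξ f := by
  induction ξ using TensorProduct.induction_on with
  | zero => simp
  | add ξ ξ' h h' => simp only [map_add, Derivation.add_apply, h, h']
  | tmul c D => rfl

/-- The orbit map intertwines an element of `𝔥 · E`, which is linear over the invariant functions,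
with the corresponding left translation. -/
lemma leftDerivationExt_inclusionLie_orbit {p : ℕ} [Fact p.Prime] [CharP k p]
    (hA : IsHeightOne p k A) (ξ : ρ.fixedField ⊗[k] Lie k A) (f : F) :
    leftDerivationExt F (ρ.inclusionLie ξ) (ρ.orbit f) = ρ.orbit (ρ.derivationFixed ξ f) := by
  induction ξ using TensorProduct.induction_on with
  | zero => simp
  | add ξ ξ' h h' => simp only [map_add, Derivation.add_apply, h, h']
  | tmul c D =>
    rw [derivationFixed_tmul_apply, map_mul, ρ.orbit_of_mem_fixedField hA c.2]
    exact (ρ.leftDerivationExt_orbit _ D f).trans (Algebra.smul_def _ _)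

/-- An invariant derivation of `H_E`, extended to `H_F`, which corresponds under the orbit map to
an operator on `F`, forces this operator to belong to `𝔥 · E`. -/
lemma exists_mem_lieE [Module.Finite k (Lie k A)]
    (δ : Derivation ρ.fixedField (ρ.fixedField ⊗[k] A) (ρ.fixedField ⊗[k] A))
    (δF : F ⊗[k] A →ₗ[F] F ⊗[k] A) (d : F → F)
    (hδ : ∀ x, δF (ρ.inclusionExt x) = ρ.inclusionExt (δ x))
    (hd : ∀ f, δF (ρ.orbit f) = ρ.orbit (d f)) :
    ∃ D ∈ ρ.lieE, ∀ f, D f = d f := by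
  let ζ : LieExt k A ρ.fixedField :=
    ⟨((augmentation k A ρ.fixedField).toLinearMap ∘ₗ δ.toLinearMap).restrictScalars k ∘ₗ
      (Algebra.TensorProduct.includeRight : A →ₐ[k] ρ.fixedField ⊗[k] A).toLinearMap, by
      intro a b
      have h1 : ((1 : ρ.fixedField) ⊗ₜ[k] (a * b)) = 1 ⊗ₜ a * 1 ⊗ₜ b := by simp
      change augmentation k A ρ.fixedField (δ (1 ⊗ₜ (a * b))) =
        algebraMap k ρ.fixedField (Coalgebra.counit (R := k) a) *
            augmentation k A ρ.fixedField (δ (1 ⊗ₜ b)) +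
          algebraMap k ρ.fixedField (Coalgebra.counit (R := k) b) *
            augmentation k A ρ.fixedField (δ (1 ⊗ₜ a))
      rw [h1, Derivation.leibniz, map_add, smul_eq_mul, smul_eq_mul, map_mul, map_mul,
        augmentation_tmul, augmentation_tmul, one_mul, one_mul]⟩
  obtain ⟨η, hη⟩ := (lieBaseChange_bijective (k := k) (A := A) ρ.fixedField).2 ζ
  refine ⟨ρ.derivationFixed η, ?_, fun f => ?_⟩
  · rw [← range_derivationFixed]
    exact ⟨η, rfl⟩
  · have h1 : tangentForm k A F (ρ.inclusionLie η) =
        (augmentation k A F).toLinearMap ∘ₗ δF := by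
      ext a
      have h2 : ρ.inclusionExt (1 ⊗ₜ a) = 1 ⊗ₜ a := by simp [inclusionExt]
      have h3 := congrArg (augmentation k A F) (hδ (1 ⊗ₜ a))
      rw [h2, augmentation_inclusionExt] at h3
      refine (augmentation_rightDerivationExt F _ a).trans ?_
      rw [lieBaseChange_inclusionLie, hη]
      exact h3.symm
    rw [← derivationF_inclusionLie, ← tangentForm_orbit, h1, LinearMap.comp_apply, hd]
    exact ρ.augmentation_orbit _

theorem lie_mem_lieE {p : ℕ} [Fact p.Prime] [CharP k p] (hA : IsHeightOne p k A)
    {D D' : Derivation ρ.fixedField F F} (hD : D ∈ ρ.lieE) (hD' : D' ∈ ρ.lieE) :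
    ⁅D, D'⁆ ∈ ρ.lieE := by
  have := hA.finite_lie
  rw [← range_derivationFixed] at hD hD'
  obtain ⟨ξ, rfl⟩ := hD
  obtain ⟨ξ', rfl⟩ := hD'
  obtain ⟨D, hD, h⟩ := ρ.exists_mem_lieE
    ⁅leftDerivationExt ρ.fixedField ξ, leftDerivationExt ρ.fixedField ξ'⁆
    ⁅leftDerivationExt F (ρ.inclusionLie ξ), leftDerivationExt F (ρ.inclusionLie ξ')⁆.toLinearMap
    (⇑(⁅ρ.derivationFixed ξ, ρ.derivationFixed ξ'⁆ : Derivation ρ.fixedField F F))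
    (fun x => by
      refine Eq.trans ?_ ((congrArg ρ.inclusionExt (Derivation.commutator_apply x)).trans
        (map_sub ρ.inclusionExt _ _)).symm
      rw [Derivation.coeFn_coe, Derivation.commutator_apply, leftDerivationExt_inclusionExt,
        leftDerivationExt_inclusionExt, leftDerivationExt_inclusionExt,
        leftDerivationExt_inclusionExt])
    (fun f => by
      rw [Derivation.coeFn_coe, Derivation.commutator_apply, Derivation.commutator_apply,
        map_sub, ρ.leftDerivationExt_inclusionLie_orbit hA,
        ρ.leftDerivationExt_inclusionLie_orbit hA, ρ.leftDerivationExt_inclusionLie_orbit hA,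
        ρ.leftDerivationExt_inclusionLie_orbit hA])
  rwa [← Derivation.ext h]

theorem iterate_mem_lieE {p : ℕ} [Fact p.Prime] [CharP k p] (hA : IsHeightOne p k A)
    {D : Derivation ρ.fixedField F F} (hD : D ∈ ρ.lieE) :
    ∃ D' ∈ ρ.lieE, ∀ f : F, D' f = (⇑D)^[p] f := by
  have := hA.finite_lie
  have := nontrivial_of_hopfAlgebra k A
  have : CharP (ρ.fixedField ⊗[k] A) p :=
    charP_of_injective_algebraMap (algebraMap k (ρ.fixedField ⊗[k] A)).injective p
  rw [← range_derivationFixed] at hD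
  obtain ⟨ξ, rfl⟩ := hD
  refine ρ.exists_mem_lieE (derivationPow p (leftDerivationExt ρ.fixedField ξ))
    ((leftDerivationExt F (ρ.inclusionLie ξ)).toLinearMap ^ p) _ (fun x => ?_) (fun f => ?_)
  · rw [derivationPow_apply, Module.End.pow_apply]
    exact (Function.Semiconj.iterate_right
      (fun x => (ρ.leftDerivationExt_inclusionExt ξ x).symm) p x).symm
  · rw [Module.End.pow_apply]
    exact (Function.Semiconj.iterate_right
      (fun f => (ρ.leftDerivationExt_inclusionLie_orbit hA ξ f).symm) p f).symm

/-! ### The inertia Lie algebra and the differential of the action -/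

/-- The linear condition that defines the inertia Lie algebra computes the derivations in
`Der_E(F)`. -/
lemma mul_rTensor_coact (ξ : F ⊗[k] Lie k A) (f : F) :
    LinearMap.mul' k F ((lieBaseChange k A F ξ).1.rTensor F (ρ.coact f)) =
      ρ.derivationF ξ f := by
  have key : ∀ x : A ⊗[k] F, LinearMap.mul' k F ((lieBaseChange k A F ξ).1.rTensor F x) =
      tangentForm k A F ξ (Algebra.TensorProduct.comm k A F x) := by
    intro x
    induction x using TensorProduct.induction_on with
    | zero => simp
    | add x y hx hy => simp only [map_add, hx, hy]
    | tmul a f =>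
      have h1 : f ⊗ₜ[k] a = f • (1 : F) ⊗ₜ[k] a := by
        rw [TensorProduct.smul_tmul', smul_eq_mul, mul_one]
      rw [Algebra.TensorProduct.comm_tmul, h1, map_smul, tangentForm_apply,
        augmentation_rightDerivationExt, smul_eq_mul, mul_comm]
      rfl
  rw [key, ← tangentForm_orbit, orbit_apply]

theorem comap_inertiaLie :
    ρ.inertiaLie.comap (lieBaseChange k A F) = LinearMap.ker ρ.derivationF := by
  ext ξ
  have h1 : ∀ f, Algebra.TensorProduct.productMap (1 : Points k A F).ofConv (AlgHom.id k F)
      (ρ.coact f) = f := fun f => AlgHom.congr_fun (ρ.act_one (AlgHom.id k F)) f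
  have h2 : ξ ∈ ρ.inertiaLie.comap (lieBaseChange k A F) ↔
      tangentPoint k A F (lieBaseChange k A F ξ) ∈ ρ.inertia (DualNumber F) := Iff.rfl
  rw [h2, mem_inertia_tangentPoint]
  simp only [h1, true_and, mul_rTensor_coact]
  exact ⟨fun h => Derivation.ext h, fun h f => by rw [LinearMap.mem_ker.1 h]; rfl⟩

/-- A map and a subspace that correspond under an isomorphism have the same rank and
codimension. -/
lemma _root_.LinearMap.finrank_quotient_eq_finrank_range {K M N P : Type*} [Field K]
    [AddCommGroup M] [Module K M] [AddCommGroup N] [Module K N] [AddCommGroup P] [Module K P]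
    (Φ : M →ₗ[K] N) (hΦ : Function.Bijective Φ) (J : Submodule K N) (g : M →ₗ[K] P)
    (h : J.comap Φ = LinearMap.ker g) :
    Module.finrank K (N ⧸ J) = Module.finrank K (LinearMap.range g) := by
  rw [← g.quotKerEquivRange.finrank_eq]
  refine (Submodule.Quotient.equiv _ _ (LinearEquiv.ofBijective Φ hΦ) ?_).finrank_eq.symm
  rw [← h]
  exact Submodule.map_comap_eq_of_surjective hΦ.2 J

theorem inertiaCodim_eq [Module.Finite k (Lie k A)] :
    ρ.inertiaCodim = Module.finrank F ρ.lieF := by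
  rw [← range_derivationF]
  exact LinearMap.finrank_quotient_eq_finrank_range _ (lieBaseChange_bijective F) _ _
    ρ.comap_inertiaLie

/-- An element of the Lie algebra that acts trivially gives a point over the dual numbers that acts
trivially. -/
theorem derivation_injective (hρ : ρ.Faithful) : Function.Injective ρ.derivation := by
  rw [injective_iff_map_eq_zero]
  intro D hD
  have h1 : tangentPoint k A k D = 1 := by
    refine hρ (DualNumber k) _ fun S _ _ _ _ z => ?_
    have key : ∀ x : A ⊗[k] F, Algebra.TensorProduct.productMap
        ((tangentPoint k A k D).map S).ofConv z x =
        z (Algebra.TensorProduct.lid k F (Algebra.TensorProduct.map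
          (Bialgebra.counitAlgHom k A) (AlgHom.id k F) x)) +
        algebraMap (DualNumber k) S DualNumber.eps *
          z (TensorProduct.lid k F (D.1.rTensor F x)) := by
      intro x
      induction x using TensorProduct.induction_on with
      | zero => simp
      | add x y hx hy => simp only [map_add, hx, hy]; ring
      | tmul a f =>
        have h2 : (tangentPoint k A k D).ofConv a =
            algebraMap k (DualNumber k) (Coalgebra.counit (R := k) a) +
              DualNumber.eps * algebraMap k (DualNumber k) (D.1 a) := by
          ext <;> simp [tangentPoint, TrivSqZeroExt.algebraMap_eq_inl']
        have h3 : ((tangentPoint k A k D).map S).ofConv a =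
            algebraMap (DualNumber k) S ((tangentPoint k A k D).ofConv a) := rfl
        rw [Algebra.TensorProduct.productMap_apply_tmul, h3, h2]
        simp [Algebra.smul_def, ← IsScalarTower.algebraMap_apply]
        ring
    ext f
    refine (key (ρ.coact f)).trans ?_
    rw [ρ.counit_coact, ← derivation_apply, hD]
    simp
  ext a
  have h2 := congrArg (fun g : Points k A (DualNumber k) => (g.ofConv a).snd) h1
  simpa [tangentPoint, AlgHom.convOne_def, Algebra.ofId_apply, TrivSqZeroExt.algebraMap_eq_inl']
    using h2

lemma exists_linearIndepOn_subset_range (h : ρ.lieF = ⊤) :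
    ∃ s ⊆ Set.range ρ.derivationE, LinearIndepOn F id s ∧ Submodule.span F s = ⊤ := by
  obtain ⟨s, hs, -, h1, h2⟩ := exists_linearIndepOn_extension (v := id)
    (linearIndepOn_empty F (id : Derivation ρ.fixedField F F → _))
    (Set.empty_subset (Set.range ρ.derivationE))
  rw [Set.image_id, Set.image_id] at h1
  refine ⟨s, hs, h2, top_le_iff.1 ?_⟩
  rw [← h]
  exact Submodule.span_le.2 h1

lemma derivationF_surjective (h : ρ.lieF = ⊤) : Function.Surjective ρ.derivationF := by
  rw [← LinearMap.range_eq_top, range_derivationF, h]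

end Action
end FixedField

/-! ### Products with the generic point -/

section Schemes

open CategoryTheory AlgebraicGeometry MonoidalCategory CartesianMonoidalCategory
open scoped MonObj

lemma isPullback_snd_whiskerLeft {C : Type*} [Category* C] [CartesianMonoidalCategory C] (T : C)
    {X Z : C} (f : Z ⟶ X) : IsPullback (snd T Z) (T ◁ f) f (snd T X) := by
  refine ⟨⟨by simp⟩, ⟨Limits.PullbackCone.IsLimit.mk _
    (fun s => lift (s.snd ≫ fst T X) s.fst) (fun s => by simp) (fun s => ?_) fun s m h1 h2 => ?_⟩⟩
  · ext
    · simp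
    · simpa using s.condition
  · ext
    · simp [← h2]
    · simpa using h1

/-- Two morphisms to a separated scheme that agree after composition with a scheme-theoretically
dominant morphism are equal. -/
lemma eq_of_comp_eq_of_isSchemeTheoreticallyDominant {S : Scheme.{u}} {W Z X : Over S}
    [IsSeparated X.hom] (j : W ⟶ Z) [IsSchemeTheoreticallyDominant j.left] {φ ψ : Z ⟶ X}
    (h : j ≫ φ = j ≫ ψ) : φ = ψ := by
  have h1 : IsIso (Limits.equalizer.ι φ ψ).left := by
    rw [IsClosedImmersion.isIso_iff_ker_eq_bot, ← le_bot_iff,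
      ← Scheme.Hom.ker_eq_bot j.left, ← Limits.equalizer.lift_ι j h, Over.comp_left]
    exact Scheme.Hom.le_ker_comp _ _
  have : IsIso ((Over.forget S).map (Limits.equalizer.ι φ ψ)) := h1
  have : IsIso (Limits.equalizer.ι φ ψ) := isIso_of_reflects_iso _ (Over.forget S)
  exact Limits.eq_of_epi_equalizer

variable {k : Type u} [Field k]

lemma specMap_comp {R S T : Type u} [CommRing R] [Algebra k R] [CommRing S] [Algebra k S]
    [CommRing T] [Algebra k T] (φ : R →ₐ[k] S) (ψ : S →ₐ[k] T) :
    specMap (ψ.comp φ) = specMap ψ ≫ specMap φ := by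
  ext1
  change Spec.map (CommRingCat.ofHom φ.toRingHom ≫ CommRingCat.ofHom ψ.toRingHom) = _
  rw [Spec.map_comp]
  rfl

lemma specMap_id (R : Type u) [CommRing R] [Algebra k R] :
    specMap (AlgHom.id k R) = 𝟙 (specOver k R) := by
  ext1
  exact Spec.map_id _

lemma specMap_injective {R S : Type u} [CommRing R] [Algebra k R] [CommRing S] [Algebra k S]
    {φ ψ : R →ₐ[k] S} (h : specMap φ = specMap ψ) : φ = ψ := by
  have h1 := Spec.map_injective (congrArg (fun f => f.left) h)
  ext r
  exact congr($h1 r)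

/-- The comparison morphism from the spectrum of a tensor product to the product of the spectra. -/
def specProduct (R S : Type u) [CommRing R] [Algebra k R] [CommRing S] [Algebra k S] :
    specOver k (R ⊗[k] S) ⟶ specOver k R ⊗ specOver k S :=
  lift (specMap Algebra.TensorProduct.includeLeft) (specMap Algebra.TensorProduct.includeRight)

instance isIso_specProduct_left (R S : Type u) [CommRing R] [Algebra k R] [CommRing S]
    [Algebra k S] : IsIso (specProduct (k := k) R S).left := by
  have h : (specProduct R S).left = (pullbackSpecIso k R S).inv := by
    apply Limits.pullback.hom_ext
    · exact (congrArg (fun f : specOver k (R ⊗[k] S) ⟶ specOver k R => f.left)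
        (lift_fst _ _)).trans (pullbackSpecIso_inv_fst k R S).symm
    · exact (congrArg (fun f : specOver k (R ⊗[k] S) ⟶ specOver k S => f.left)
        (lift_snd _ _)).trans (pullbackSpecIso_inv_snd k R S).symm
  rw [h]
  exact Iso.isIso_inv (pullbackSpecIso k R S)

variable (X : Over (Spec (.of k))) [IsIntegral X.left]

instance mono_genericInclusion : Mono (genericInclusion X) := by
  have : Mono (genericInclusion X).left :=
    inferInstanceAs (Mono (X.left.fromSpecStalk (genericPoint X.left)))
  exact Over.mono_of_mono_left _

instance quasiCompact_genericInclusion [IsProper X.hom] :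
    QuasiCompact (genericInclusion X).left := by
  have : QuasiCompact ((genericInclusion X).left ≫ X.hom) := by
    rw [Over.w]
    exact inferInstanceAs (QuasiCompact (Spec.map _))
  exact QuasiCompact.of_comp _ X.hom

instance isSchemeTheoreticallyDominant_genericInclusion :
    IsSchemeTheoreticallyDominant (genericInclusion X).left := by
  have : IsDominant (genericInclusion X).left := by
    refine ⟨dense_iff_closure_eq.2 (Set.univ_subset_iff.1 ?_)⟩
    rw [← (genericPoint_spec X.left).def]
    exact closure_mono (Set.singleton_subset_iff.2
      ⟨IsLocalRing.closedPoint _, Scheme.fromSpecStalk_closedPoint⟩)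
  exact .of_isDominant _

variable (R : Type u) [CommRing R] [Algebra k R]

/-- The inclusion of `Spec(R ⊗ k(X)) = Spec(R) × Spec(k(X))` in `Spec(R) × X`. -/
def productInclusion : specOver k (R ⊗[k] FunctionField X) ⟶ specOver k R ⊗ X :=
  lift (specMap Algebra.TensorProduct.includeLeft)
    (specMap Algebra.TensorProduct.includeRight ≫ genericInclusion X)

lemma productInclusion_eq : productInclusion X R =
    specProduct R (FunctionField X) ≫ specOver k R ◁ genericInclusion X := by
  simp [productInclusion, specProduct]

instance flat_snd_specOver : Flat (snd (specOver k R) X).left := by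
  have : Flat (specOver k R).hom := by
    change Flat (Spec.map (CommRingCat.ofHom (algebraMap k R)))
    rw [Flat.SpecMap_iff, CommRingCat.hom_ofHom, RingHom.flat_algebraMap_iff]
    infer_instance
  exact inferInstanceAs (Flat (Limits.pullback.snd (specOver k R).hom X.hom))

lemma isPullback_whiskerLeft_genericInclusion :
    IsPullback (snd (specOver k R) (specOver k (FunctionField X))).left
      (specOver k R ◁ genericInclusion X).left
      (genericInclusion X).left (snd (specOver k R) X).left :=
  (isPullback_snd_whiskerLeft (specOver k R) (genericInclusion X)).map (Over.forget _)

instance [IsProper X.hom] : IsSchemeTheoreticallyDominant (productInclusion X R).left := by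
  have := IsSchemeTheoreticallyDominant.of_isPullback
    (isPullback_whiskerLeft_genericInclusion X R)
  rw [productInclusion_eq, Over.comp_left]
  infer_instance

instance [IsProper X.hom] : QuasiCompact (productInclusion X R).left := by
  have : QuasiCompact (specOver k R ◁ genericInclusion X).left :=
    MorphismProperty.of_isPullback (isPullback_whiskerLeft_genericInclusion X R) inferInstance
  rw [productInclusion_eq, Over.comp_left]
  infer_instance

end Schemes

/-! ### The action on the generic point -/

section Induced

open CategoryTheory AlgebraicGeometry MonoidalCategory CartesianMonoidalCategory
open scoped MonObj

variable {k A : Type u} [Field k] [CommRing A] [HopfAlgebra k A]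

lemma specMap_mul {R : Type u} [CommRing R] [Algebra k R] (g h : Points k A R) :
    specMap (g * h).ofConv = specMap g.ofConv * specMap h.ofConv :=
  map_mul Spec.mapMulEquiv g h

lemma specMap_one {R : Type u} [CommRing R] [Algebra k R] :
    specMap (1 : Points k A R).ofConv = 1 :=
  map_one Spec.mapMulEquiv

lemma IsHeightOne.isUnit_of_isUnit_augmentation {p : ℕ} [Fact p.Prime] (hA : IsHeightOne p k A)
    (L : Type u) [Field L] [Algebra k L] [CharP k p] (x : L ⊗[k] A)
    (hx : IsUnit (augmentation k A L x)) : IsUnit x := by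
  rw [← isUnit_pow_iff (Fact.out : p.Prime).ne_zero, hA.pow_eq_augmentation]
  exact (hx.pow p).map _

variable (A) in
/-- The comorphism of the base change of the unit section. -/
def unitComorphism (L : Type u) [CommRing L] [Algebra k L] : A ⊗[k] L →ₐ[k] L :=
  Algebra.TensorProduct.productMap (1 : Points k A L).ofConv (AlgHom.id k L)

lemma IsHeightOne.isLocalHom_unitComorphism {p : ℕ} [Fact p.Prime] [CharP k p]
    (hA : IsHeightOne p k A) (L : Type u) [Field L] [Algebra k L] :
    IsLocalHom (unitComorphism (k := k) A L).toRingHom := by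
  have key : ∀ x : A ⊗[k] L, unitComorphism (k := k) A L x =
      augmentation k A L (Algebra.TensorProduct.comm k A L x) := by
    intro x
    induction x using TensorProduct.induction_on with
    | zero => simp
    | add x y hx hy => simp only [map_add, hx, hy]
    | tmul a c => simp [unitComorphism, AlgHom.convOne_def, Algebra.ofId_apply, mul_comm]
  refine ⟨fun x hx => ?_⟩
  have hx' : IsUnit (unitComorphism (k := k) A L x) := hx
  rw [key] at hx'
  have h1 := (hA.isUnit_of_isUnit_augmentation L _ hx').map
    (Algebra.TensorProduct.comm k A L).symm
  simpa using h1

variable (X : Over (Spec (.of k))) [IsIntegral X.left]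

/-- A morphism from the spectrum of a local ring that maps the closed point to the generic point
factors through the spectrum of the function field. -/
lemma exists_specMap_comp_genericInclusion {B : Type u} [CommRing B] [Algebra k B] [IsLocalRing B]
    (m : specOver k B ⟶ X)
    (h : m.left (IsLocalRing.closedPoint B) = genericPoint X.left) :
    ∃ φ : FunctionField X →ₐ[k] B, specMap φ ≫ genericInclusion X = m := by
  have h1 : ∀ x : X.left, m.left (IsLocalRing.closedPoint B) = x →
      ∃ ψ : X.left.presheaf.stalk x ⟶ .of B, Spec.map ψ ≫ X.left.fromSpecStalk x = m.left := by
    rintro _ rfl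
    exact ⟨_, Scheme.Spec_stalkClosedPointTo_fromSpecStalk (R := .of B) m.left⟩
  obtain ⟨ψ, hψ⟩ := h1 _ h
  have h2 : CommRingCat.ofHom (algebraMap k (FunctionField X)) ≫ ψ =
      CommRingCat.ofHom (algebraMap k B) := by
    apply Spec.map_injective
    rw [Spec.map_comp]
    have h3 : Spec.map (CommRingCat.ofHom (algebraMap k (FunctionField X))) =
        X.left.fromSpecStalk (genericPoint X.left) ≫ X.hom := (Over.w (genericInclusion X)).symm
    rw [h3, ← Category.assoc, hψ]
    exact Over.w m
  let φ : FunctionField X →ₐ[k] B :=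
    { ψ.hom with commutes' := fun r => congr($h2 r) }
  refine ⟨φ, ?_⟩
  ext1
  exact hψ

variable [ModObj (specOver k A) X]

lemma specMap_comp_smul_genericInclusion {R S : Type u} [CommRing R] [Algebra k R] [CommRing S]
    [Algebra k S] (φ : R →ₐ[k] S) (g : A →ₐ[k] R) (z : FunctionField X →ₐ[k] R) :
    specMap φ ≫ (specMap g • (specMap z ≫ genericInclusion X)) =
      specMap (φ.comp g) • (specMap (φ.comp z) ≫ genericInclusion X) := by
  rw [ModObj.comp_smul, ← Category.assoc, specMap_comp, specMap_comp]

variable (A) in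
/-- The universal translate of the generic point. -/
def genericTranslate : specOver k (A ⊗[k] FunctionField X) ⟶ X :=
  specMap (Algebra.TensorProduct.includeLeft : A →ₐ[k] A ⊗[k] FunctionField X) •
    (specMap Algebra.TensorProduct.includeRight ≫ genericInclusion X)

lemma specMap_comp_genericTranslate {R : Type u} [CommRing R] [Algebra k R]
    (φ : A ⊗[k] FunctionField X →ₐ[k] R) :
    specMap φ ≫ genericTranslate A X =
      specMap (φ.comp Algebra.TensorProduct.includeLeft) •
        (specMap (φ.comp Algebra.TensorProduct.includeRight) ≫ genericInclusion X) :=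
  specMap_comp_smul_genericInclusion X _ _ _

lemma specMap_productMap_comp_genericTranslate {R : Type u} [CommRing R] [Algebra k R]
    (g : A →ₐ[k] R) (z : FunctionField X →ₐ[k] R) :
    specMap (Algebra.TensorProduct.productMap g z) ≫ genericTranslate A X =
      specMap g • (specMap z ≫ genericInclusion X) := by
  rw [specMap_comp_genericTranslate, Algebra.TensorProduct.productMap_left,
    Algebra.TensorProduct.productMap_right]

/-- A homomorphism of algebras that describes the universal translate of the generic point is an
action on the spectrum of the function field. The axioms hold because the inclusion of the generic
point is a monomorphism. -/
def actionOfComorphism (φ : FunctionField X →ₐ[k] A ⊗[k] FunctionField X)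
    (hφ : specMap φ ≫ genericInclusion X = genericTranslate A X) :
    Action (k := k) (A := A) (FunctionField X) where
  coact := φ
  counit_coact := by
    suffices h : ((Algebra.TensorProduct.lid k (FunctionField X)).toAlgHom.comp
        (Algebra.TensorProduct.map (Bialgebra.counitAlgHom k A)
          (AlgHom.id k (FunctionField X)))).comp φ = AlgHom.id k _ from
      fun c => AlgHom.congr_fun h c
    apply specMap_injective
    rw [← cancel_mono (genericInclusion X), specMap_comp, Category.assoc, hφ,
      specMap_comp_genericTranslate]
    have h1 : ((Algebra.TensorProduct.lid k (FunctionField X)).toAlgHom.comp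
        (Algebra.TensorProduct.map (Bialgebra.counitAlgHom k A)
          (AlgHom.id k (FunctionField X)))).comp Algebra.TensorProduct.includeLeft =
        (1 : Points k A (FunctionField X)).ofConv := by
      ext a
      simp [AlgHom.convOne_def, Algebra.ofId_apply, Algebra.algebraMap_eq_smul_one]
    have h2 : ((Algebra.TensorProduct.lid k (FunctionField X)).toAlgHom.comp
        (Algebra.TensorProduct.map (Bialgebra.counitAlgHom k A)
          (AlgHom.id k (FunctionField X)))).comp Algebra.TensorProduct.includeRight =
        AlgHom.id k (FunctionField X) := by
      ext a
      simp
    rw [h1, h2, specMap_one, one_smul]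
  comul_coact := by
    suffices h : ((Algebra.TensorProduct.assoc k k k A A (FunctionField X)).toAlgHom.comp
        (Algebra.TensorProduct.map (Bialgebra.comulAlgHom k A)
          (AlgHom.id k (FunctionField X)))).comp φ =
        (Algebra.TensorProduct.map (AlgHom.id k A) φ).comp φ from
      fun c => AlgHom.congr_fun h c
    apply specMap_injective
    rw [← cancel_mono (genericInclusion X), specMap_comp φ, specMap_comp φ,
      Category.assoc, Category.assoc, hφ, specMap_comp_genericTranslate,
      specMap_comp_genericTranslate]
    let g₁ : Points k A (A ⊗[k] (A ⊗[k] FunctionField X)) :=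
      WithConv.toConv Algebra.TensorProduct.includeLeft
    let g₂ : Points k A (A ⊗[k] (A ⊗[k] FunctionField X)) :=
      WithConv.toConv ((Algebra.TensorProduct.includeRight :
        A ⊗[k] FunctionField X →ₐ[k] A ⊗[k] (A ⊗[k] FunctionField X)).comp
          Algebra.TensorProduct.includeLeft)
    have h1 : ((Algebra.TensorProduct.assoc k k k A A (FunctionField X)).toAlgHom.comp
        (Algebra.TensorProduct.map (Bialgebra.comulAlgHom k A)
          (AlgHom.id k (FunctionField X)))).comp Algebra.TensorProduct.includeLeft =
        (g₁ * g₂).ofConv := by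
      ext a
      rw [AlgHom.convMul_def]
      simp only [AlgHom.comp_apply, Algebra.TensorProduct.includeLeft_apply,
        Algebra.TensorProduct.map_tmul, Bialgebra.comulAlgHom_apply, map_one]
      induction Coalgebra.comul (R := k) a using TensorProduct.induction_on with
      | zero => simp
      | add x y hx hy => simp only [map_add, TensorProduct.add_tmul, hx, hy]
      | tmul a b => simp [g₁, g₂]
    have h2 : (Algebra.TensorProduct.map (AlgHom.id k A) φ).comp
        Algebra.TensorProduct.includeLeft = g₁.ofConv := by
      ext a
      simp [g₁]
    have h3 : (Algebra.TensorProduct.map (AlgHom.id k A) φ).comp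
        Algebra.TensorProduct.includeRight =
          (Algebra.TensorProduct.includeRight :
            A ⊗[k] FunctionField X →ₐ[k] A ⊗[k] (A ⊗[k] FunctionField X)).comp φ := by
      ext a
      simp
    have h4 : ((Algebra.TensorProduct.assoc k k k A A (FunctionField X)).toAlgHom.comp
        (Algebra.TensorProduct.map (Bialgebra.comulAlgHom k A)
          (AlgHom.id k (FunctionField X)))).comp Algebra.TensorProduct.includeRight =
        (Algebra.TensorProduct.includeRight :
          A ⊗[k] FunctionField X →ₐ[k] A ⊗[k] (A ⊗[k] FunctionField X)).comp
            Algebra.TensorProduct.includeRight := by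
      ext a
      simp [Algebra.TensorProduct.one_def]
    rw [h1, h2, h3, h4, specMap_comp φ, Category.assoc, hφ, specMap_comp_genericTranslate,
      specMap_mul, mul_smul]

variable {X}

/-- An action on the spectrum of the function field is induced by the action on the scheme if and
only if its comorphism describes the universal translate of the generic point. -/
lemma isInducedAction_iff (ρ : Action (k := k) (A := A) (FunctionField X)) :
    IsInducedAction X ρ ↔ specMap ρ.coact ≫ genericInclusion X = genericTranslate A X := by
  constructor
  · intro h
    have h1 := h (A ⊗[k] FunctionField X) (WithConv.toConv Algebra.TensorProduct.includeLeft)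
      Algebra.TensorProduct.includeRight
    refine Eq.trans ?_ h1.symm
    congr 2
    have h2 : Algebra.TensorProduct.productMap
        (Algebra.TensorProduct.includeLeft : A →ₐ[k] A ⊗[k] FunctionField X)
        Algebra.TensorProduct.includeRight = AlgHom.id k _ := by
      ext <;> simp
    rw [Action.act, h2, AlgHom.id_comp]
  · intro h R _ _ g z
    rw [Action.act, specMap_comp, Category.assoc, h, specMap_productMap_comp_genericTranslate]
    rfl

theorem exists_isInducedAction {p : ℕ} [Fact p.Prime] [CharP k p] (hA : IsHeightOne p k A) :
    ∃ ρ : Action (k := k) (A := A) (FunctionField X), IsInducedAction X ρ := by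
  -- The spectrum of `A ⊗ k(X)` has a single point, which lies on the unit section.
  have := hA.isLocalHom_unitComorphism (FunctionField X)
  have : IsLocalRing (A ⊗[k] FunctionField X) :=
    RingHom.domain_isLocalRing (unitComorphism A (FunctionField X)).toRingHom
  have h1 : specMap (unitComorphism A (FunctionField X)) ≫ genericTranslate A X =
      genericInclusion X := by
    rw [unitComorphism, specMap_productMap_comp_genericTranslate, specMap_one, one_smul,
      specMap_id, Category.id_comp]
  obtain ⟨φ, hφ⟩ := exists_specMap_comp_genericInclusion X (genericTranslate A X) (by
    rw [← IsLocalRing.comap_closedPoint (unitComorphism A (FunctionField X)).toRingHom]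
    have h2 := congrArg (fun f => f.left (IsLocalRing.closedPoint (FunctionField X))) h1
    exact h2.trans Scheme.fromSpecStalk_closedPoint)
  exact ⟨actionOfComorphism X φ hφ, (isInducedAction_iff _).2 hφ⟩

end Induced

/-! ### The quotient and its function field -/

section Quotient

open CategoryTheory AlgebraicGeometry MonoidalCategory CartesianMonoidalCategory
open scoped MonObj

variable {k A : Type u} [Field k] [CommRing A] [HopfAlgebra k A]
  {X Y : Over (Spec (.of k))} [IsIntegral X.left] [ModObj (specOver k A) X]
  {ρ : Action (k := k) (A := A) (FunctionField X)}

lemma productInclusion_comp_smul {R : Type u} [CommRing R] [Algebra k R] (g : A →ₐ[k] R) :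
    productInclusion X R ≫ (specMap g ▷ X) ≫ ModObj.smul (M := specOver k A) (X := X) =
      specMap ((Algebra.TensorProduct.includeLeft : R →ₐ[k] R ⊗[k] FunctionField X).comp g) •
        (specMap (Algebra.TensorProduct.includeRight : FunctionField X →ₐ[k] R ⊗[k] _) ≫
          genericInclusion X) := by
  rw [Hom.smul_def, ← Category.assoc]
  congr 1
  ext1
  · simp [productInclusion, specMap_comp]
  · simp [productInclusion]

lemma productInclusion_comp_snd (R : Type u) [CommRing R] [Algebra k R] :
    productInclusion X R ≫ snd (specOver k R) X =
      specMap (Algebra.TensorProduct.includeRight : FunctionField X →ₐ[k] R ⊗[k] _) ≫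
        genericInclusion X := by
  simp [productInclusion]

/-- An automorphism of `Spec(R) × X` is determined by its restriction to the generic point of `X`,
so the induced action is faithful. -/
theorem faithful_of_isInducedAction {p : ℕ} [Fact p.Prime] [CharP k p] [IsProper X.hom]
    (hX : IsAutFrobeniusKernel p (A := A) X) (hρ : IsInducedAction X ρ) : ρ.Faithful := by
  intro R _ _ g hg
  -- `IsAutFrobeniusKernel` only concerns algebras of characteristic `p`, which excludes the zero
  -- ring.
  rcases subsingleton_or_nontrivial R with hR | hR
  · exact WithConv.ofConv_injective (AlgHom.ext fun _ => Subsingleton.elim _ _)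
  have : CharP R p := charP_of_injective_algebraMap (algebraMap k R).injective p
  refine WithConv.ofConv_injective ((hX R).injOn (Set.mem_univ _) (Set.mem_univ _) ?_)
  have h1 : ∀ g : Points k A R, (∀ z : FunctionField X →ₐ[k] R ⊗[k] FunctionField X,
      ρ.act (g.map _) z = z) →
      (specMap g.ofConv ▷ X) ≫ ModObj.smul (M := specOver k A) (X := X) = snd _ X := by
    intro g hg
    apply eq_of_comp_eq_of_isSchemeTheoreticallyDominant (productInclusion X R)
    rw [productInclusion_comp_smul, productInclusion_comp_snd]
    have h2 := hρ _ (g.map (R ⊗[k] FunctionField X)) Algebra.TensorProduct.includeRight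
    rw [hg] at h2
    exact h2
  exact (h1 g fun z => hg _ z).trans (h1 1 fun z => by
    have h3 : (1 : Points k A R).map (R ⊗[k] FunctionField X) = 1 := by
      apply WithConv.ofConv_injective
      ext a
      simp [Points.map, AlgHom.convOne_def, Algebra.ofId_apply, ← IsScalarTower.algebraMap_apply]
    rw [h3, ρ.act_one]).symm

/-- Rational functions on the quotient are invariant. -/
lemma coact_stalkMap {q : X ⟶ Y} (hq : IsQuotient A q) (hρ : IsInducedAction X ρ)
    (y : Y.left.presheaf.stalk (q.left (genericPoint X.left))) :
    ρ.coact ((q.left.stalkMap (genericPoint X.left)).hom y) =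
      1 ⊗ₜ (q.left.stalkMap (genericPoint X.left)).hom y := by
  rw [isInducedAction_iff] at hρ
  have h1 : specMap ρ.coact ≫ genericInclusion X ≫ q =
      specMap Algebra.TensorProduct.includeRight ≫ genericInclusion X ≫ q := by
    rw [reassoc_of% hρ, ← Category.assoc, ← productInclusion_comp_snd A]
    have h2 : genericTranslate A X =
        productInclusion X A ≫ ModObj.smul (M := specOver k A) (X := X) := rfl
    rw [h2, Category.assoc, Category.assoc, hq.invariant]
  let c₁ : X.left.presheaf.stalk (genericPoint X.left) ⟶ .of (A ⊗[k] FunctionField X) :=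
    CommRingCat.ofHom ρ.coact.toRingHom
  let c₂ : X.left.presheaf.stalk (genericPoint X.left) ⟶ .of (A ⊗[k] FunctionField X) :=
    CommRingCat.ofHom (Algebra.TensorProduct.includeRight :
      FunctionField X →ₐ[k] A ⊗[k] FunctionField X).toRingHom
  have h3 : Spec.map c₁ ≫ X.left.fromSpecStalk _ ≫ q.left =
      Spec.map c₂ ≫ X.left.fromSpecStalk _ ≫ q.left :=
    congrArg (fun f : specOver k (A ⊗[k] FunctionField X) ⟶ Y => f.left) h1
  rw [← Scheme.SpecMap_stalkMap_fromSpecStalk, ← Category.assoc, ← Category.assoc, cancel_mono,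
    ← Spec.map_comp, ← Spec.map_comp] at h3
  have h4 := Spec.map_injective h3
  exact congr($h4 y)

end Quotient

section Degree

open CategoryTheory AlgebraicGeometry MonoidalCategory CartesianMonoidalCategory
open scoped MonObj

/-- The pullback of a section to the spectrum of an algebra over a stalk only depends on the germ
of the section. -/
lemma SpecMap_fromSpecStalk_appLE {X : Scheme.{u}} {x : X} {B : CommRingCat.{u}}
    (c : X.presheaf.stalk x ⟶ B) {V : X.Opens} (hx : x ∈ V) (W : (Spec B).Opens)
    (h : W ≤ (Spec.map c ≫ X.fromSpecStalk x) ⁻¹ᵁ V) :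
    (Spec.map c ≫ X.fromSpecStalk x).appLE V W h =
      X.presheaf.germ V x hx ≫ c ≫ (Scheme.ΓSpecIso B).inv ≫
        (Spec B).presheaf.map (homOfLE le_top).op := by
  rw [Scheme.Hom.comp_appLE, Scheme.fromSpecStalk_app hx, Category.assoc, Category.assoc]
  congr 1
  refine (congrArg (_ ≫ ·) (Scheme.Hom.map_appLE (Spec.map c) (U := X.fromSpecStalk x ⁻¹ᵁ V)
    (U' := ⊤) h (homOfLE le_top).op)).trans ?_
  exact (Scheme.ΓSpecIso_inv_naturality_assoc c _).symm

/-- If a morphism sends the spectrum of an algebra over the stalk to the point of this stalk, the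
pullback of a section is computed from its germ. -/
lemma app_appLE_eq {X Z : Scheme.{u}} {x : X} {B : CommRingCat.{u}} (j : Spec B ⟶ Z) (a : Z ⟶ X)
    (c : X.presheaf.stalk x ⟶ B) (ha : j ≫ a = Spec.map c ≫ X.fromSpecStalk x) {V : X.Opens}
    (hx : x ∈ V) (W : Z.Opens) (h : W ≤ a ⁻¹ᵁ V) (s : Γ(X, V)) :
    j.app W (a.appLE V W h s) = (Spec B).presheaf.map (homOfLE le_top).op
      ((Scheme.ΓSpecIso B).inv (c (X.presheaf.germ V x hx s))) := by
  have key : ∀ (m : Spec B ⟶ X) (_ : m = Spec.map c ≫ X.fromSpecStalk x)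
      (h' : j ⁻¹ᵁ W ≤ m ⁻¹ᵁ V), m.appLE V (j ⁻¹ᵁ W) h' =
        X.presheaf.germ V x hx ≫ c ≫ (Scheme.ΓSpecIso B).inv ≫
          (Spec B).presheaf.map (homOfLE le_top).op := by
    rintro _ rfl h'
    exact SpecMap_fromSpecStalk_appLE c hx _ h'
  have h1 : a.appLE V W h ≫ j.app W = (j ≫ a).appLE V (j ⁻¹ᵁ W) (by
      rw [Scheme.Hom.comp_preimage]
      exact j.preimage_mono h) := by
    rw [Scheme.Hom.app_eq_appLE, Scheme.Hom.appLE_comp_appLE]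
  rw [key _ ha] at h1
  exact congr($h1 s)

variable {k A : Type u} [Field k] [CommRing A] [HopfAlgebra k A]
  {X Y : Over (Spec (.of k))} [IsIntegral X.left] [ModObj (specOver k A) X]
  {ρ : Action (k := k) (A := A) (FunctionField X)}

lemma stalkMap_injective {q : X ⟶ Y} (hq : IsQuotient A q) :
    Function.Injective (q.left.stalkMap (genericPoint X.left)).hom := by
  rw [injective_iff_map_eq_zero]
  intro y hy
  obtain ⟨U, hU, t, rfl⟩ := Y.left.presheaf.exists_germ_eq y
  have h1 : X.left.presheaf.germ (q.left ⁻¹ᵁ U) (genericPoint X.left) hU (q.left.app U t) = 0 :=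
    (Scheme.Hom.germ_stalkMap_apply q.left U _ hU t).symm.trans hy
  have : Nonempty (q.left ⁻¹ᵁ U : X.left.Opens) := ⟨⟨_, hU⟩⟩
  have h2 : q.left.app U t = 0 :=
    Scheme.germToFunctionField_injective X.left (q.left ⁻¹ᵁ U) (h1.trans (map_zero _).symm)
  rw [hq.injective U (h2.trans (map_zero _).symm), map_zero]

/-- Invariant rational functions come from the quotient: such a function is a section of `X` over
the preimage of an open set of `Y`, and its invariance can be tested at the generic point. -/
lemma exists_stalkMap_eq [IsProper X.hom] {q : X ⟶ Y} (hq : IsQuotient A q)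
    (hρ : IsInducedAction X ρ) {f : FunctionField X} (hf : ρ.coact f = 1 ⊗ₜ f) :
    ∃ y, (q.left.stalkMap (genericPoint X.left)).hom y = f := by
  obtain ⟨V, hV, s, rfl⟩ := X.left.presheaf.exists_germ_eq f
  obtain ⟨U, rfl⟩ : ∃ U : Y.left.Opens, V = q.left ⁻¹ᵁ U :=
    ⟨⟨q.left '' V, hq.isHomeomorph.isOpenMap _ V.isOpen⟩,
      TopologicalSpace.Opens.ext (hq.isHomeomorph.injective.preimage_image _).symm⟩
  rw [isInducedAction_iff] at hρ
  let c₁ : X.left.presheaf.stalk (genericPoint X.left) ⟶ .of (A ⊗[k] FunctionField X) :=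
    CommRingCat.ofHom ρ.coact.toRingHom
  let c₂ : X.left.presheaf.stalk (genericPoint X.left) ⟶ .of (A ⊗[k] FunctionField X) :=
    CommRingCat.ofHom (Algebra.TensorProduct.includeRight :
      FunctionField X →ₐ[k] A ⊗[k] FunctionField X).toRingHom
  have h1 : (productInclusion X A).left ≫ (ModObj.smul (M := specOver k A) (X := X)).left =
      Spec.map c₁ ≫ X.left.fromSpecStalk _ :=
    congrArg (fun f : specOver k (A ⊗[k] FunctionField X) ⟶ X => f.left) hρ.symm
  have h2 : (productInclusion X A).left ≫ (snd (specOver k A) X).left =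
      Spec.map c₂ ≫ X.left.fromSpecStalk _ :=
    congrArg (fun f : specOver k (A ⊗[k] FunctionField X) ⟶ X => f.left)
      (productInclusion_comp_snd A)
  obtain ⟨t, ht⟩ := (hq.range U s).2 fun W h h' => by
    apply Scheme.Hom.app_injective (productInclusion X A).left W
    have h3 := app_appLE_eq _ _ c₁ h1 hV W h s
    have h4 := app_appLE_eq _ _ c₂ h2 hV W h' s
    have h5 : c₁ (X.left.presheaf.germ _ _ hV s) = c₂ (X.left.presheaf.germ _ _ hV s) := hf
    rw [h5] at h3
    exact h3.trans h4.symm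
  refine ⟨Y.left.presheaf.germ U _ hV t, ?_⟩
  rw [← ht]
  exact Scheme.Hom.germ_stalkMap_apply q.left U _ hV t

theorem isFoliationRank_iff {p : ℕ} [Fact p.Prime] [CharP k p] [IsProper X.hom]
    (hA : IsHeightOne p k A) {q : X ⟶ Y} (hq : IsQuotient A q) (hρ : IsInducedAction X ρ) (r : ℕ) :
    IsFoliationRank p q r ↔ r = ρ.inertiaCodim := by
  have hfin := ρ.finite_fixedField hA
  have := hA.finite_lie
  have hdeg := (ρ.free_orbitComorphism hA).1
  rw [← ρ.inertiaCodim_eq] at hdeg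
  let φ := (q.left.stalkMap (genericPoint X.left)).hom
  let e : Y.left.presheaf.stalk (q.left (genericPoint X.left)) ≃+* ρ.fixedField :=
    RingEquiv.ofBijective
      (φ.codRestrict ρ.fixedField fun y =>
        (ρ.mem_fixedField_iff_coact hA).2 (coact_stalkMap hq hρ y))
      ⟨fun y y' h => stalkMap_injective hq (congrArg Subtype.val h), fun f => by
        obtain ⟨y, hy⟩ := exists_stalkMap_eq hq hρ ((ρ.mem_fixedField_iff_coact hA).1 f.2)
        exact ⟨y, Subtype.ext hy⟩⟩
  let : Algebra (Y.left.presheaf.stalk (q.left (genericPoint X.left))) (FunctionField X) :=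
    φ.toAlgebra
  have hcomp : (algebraMap ρ.fixedField (FunctionField X)).comp e.toRingHom =
      (RingEquiv.refl (FunctionField X)).toRingHom.comp (algebraMap _ (FunctionField X)) := rfl
  have h1 : Module.Finite (Y.left.presheaf.stalk (q.left (genericPoint X.left)))
      (FunctionField X) := Module.Finite.of_equiv_equiv e.symm (RingEquiv.refl _) (by
        refine RingHom.ext fun f => ?_
        exact congrArg Subtype.val (e.apply_symm_apply f))
  have h2 : Module.finrank (Y.left.presheaf.stalk (q.left (genericPoint X.left)))
      (FunctionField X) = p ^ ρ.inertiaCodim := by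
    rw [← hdeg]
    exact Algebra.finrank_eq_of_equiv_equiv e (RingEquiv.refl _) hcomp
  have hp : p.Prime := Fact.out
  refine ⟨fun h => Nat.pow_right_injective hp.two_le (h.2.symm.trans h2), ?_⟩
  rintro rfl
  exact ⟨h1, h2⟩

end Degree

end HeightOneAction

end

theorem mainTheorem6 (p : ℕ) [Fact p.Prime] (k A : Type u) [Field k] [CharP k p]
    [CommRing A] [HopfAlgebra k A] (hA : IsHeightOne p k A) :
    (∀ (F : Type u) [Field F] [Algebra k F] (ρ : HeightOneAction.Action (k := k) (A := A) F), ρ.Faithful →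
      Function.Injective ρ.derivation ∧
      (∃ s ⊆ Set.range ρ.derivationE, LinearIndepOn F id s ∧ Submodule.span F s = ⊤) ∧
      ρ.lieF = ⊤ ∧
      (∀ f : F, f ∈ ρ.fixedField ↔ ∀ D ∈ ρ.lieE, D f = 0) ∧
      (∀ f : F, f ∈ ρ.fixedField ↔ ∀ D ∈ ρ.lieF, D f = 0) ∧
      (∀ D ∈ ρ.lieE, ∀ D' ∈ ρ.lieE, ⁅D, D'⁆ ∈ ρ.lieE) ∧
      (∀ D ∈ ρ.lieE, ∃ D' ∈ ρ.lieE, ∀ f : F, D' f = (⇑D)^[p] f) ∧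
      Module.Finite ρ.fixedField F ∧
      Module.finrank ρ.fixedField F = p ^ Module.finrank F ρ.lieF ∧
      ρ.IsTransitive ∧
      (∃ π : F ⊗[ρ.fixedField] F →ₐ[F] F ⊗[k] A,
        ρ.IsOrbitComorphism π ∧ ρ.IsInertiaQuotient π) ∧
      Function.Bijective (lieBaseChange k A F) ∧
      Function.Surjective ρ.derivationF ∧
      ρ.inertiaLie.comap (lieBaseChange k A F) = LinearMap.ker ρ.derivationF ∧
      Module.finrank ρ.fixedField F = p ^ ρ.inertiaCodim) ∧
    (∀ (X Y : Over (Spec (.of k))) [IsIntegral X.left] [IsProper X.hom]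
      [ModObj (specOver k A) X] (q : X ⟶ Y),
      IsAutFrobeniusKernel p (A := A) X → IsQuotient A q →
      (∃ ρ : HeightOneAction.Action (k := k) (A := A) (HeightOneAction.FunctionField X), IsInducedAction X ρ) ∧
      ∀ ρ : HeightOneAction.Action (k := k) (A := A) (HeightOneAction.FunctionField X), IsInducedAction X ρ →
        ρ.Faithful ∧ ∀ r : ℕ, IsFoliationRank p q r ↔ r = ρ.inertiaCodim) := by
  refine ⟨fun F _ _ ρ hρ => ?_, ?_⟩
  · have := hA.finite_lie
    have htop := ρ.lieF_eq_top hA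
    have hfin := ρ.finite_fixedField hA
    obtain ⟨hdeg, -⟩ := ρ.free_orbitComorphism hA
    exact ⟨ρ.derivation_injective hρ, ρ.exists_linearIndepOn_subset_range htop, htop,
      ρ.mem_fixedField_iff_lieE, ρ.mem_fixedField_iff_lieF,
      fun D hD D' hD' => ρ.lie_mem_lieE hA hD hD', fun D hD => ρ.iterate_mem_lieE hA hD,
      hfin, hdeg, ρ.isTransitive hA,
      ⟨ρ.orbitComorphism hA, ρ.isOrbitComorphism hA, ρ.isInertiaQuotient hA⟩,
      lieBaseChange_bijective F, ρ.derivationF_surjective htop, ρ.comap_inertiaLie,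
      by rw [ρ.inertiaCodim_eq, hdeg]⟩
  · intro X Y _ _ _ q hX hq
    exact ⟨exists_isInducedAction hA, fun ρ hρ =>
      ⟨faithful_of_isInducedAction hX hρ, isFoliationRank_iff hA hq hρ⟩⟩
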